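/- Theorem 1.1 (Main Result). Let $g_0(t)=2^{1/4}e^{-\pi t^2}$ be the normalized standard Gaussian on $\mathbb{R}$. For $g\in L^2(\mathbb{R})$, write $\pi(x,\omega)g(t)=e^{2\pi i\omega t}g(t-x)$, $\langle f,g\rangle=\int_{\mathbb{R}}f(t)\overline{g(t)}\,dt$, and $V_gf(x,\omega)=\int_{\mathbb{R}}f(t)\overline{g(t-x)}e^{-2\pi i\omega t}\,dt$. For $\alpha,\beta>0$ let $\Lambda_{(\alpha,\beta)}=\alpha\mathbb{Z}\times\beta\mathbb{Z}$ and $\Lambda^\circ_{(\alpha,\beta)}=\tfrac1\beta\mathbb{Z}\times\tfrac1\alpha\mathbb{Z}$. Let $A(\alpha,\beta)$ be the optimal lower frame bound of the Gabor system $\{\pi(\lambda)g_0:\lambda\in\Lambda_{(\alpha,\beta)}\}$, that is, the largest $A\ge 0$ such that $$A\,\|f\|_2^2\le\sum_{\lambda\in\Lambda_{(\alpha,\beta)}}|\langle f,\pi(\lambda)g_0\rangle|^2\qquad\text{for all } f\in L^2(\mathbb{R}),$$ and let $$\widetilde B(\alpha,\beta)=\sum_{\lambda^\circ\in\Lambda^\circ_{(\alpha,\beta)}}|V_{g_0}g_0(\lambda^\circ)|$$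 be the (re-normalized) Tolimieri–Orr bound. Let $\alpha,\beta>0$ with $(\alpha\beta)^{-1}=2$. Then $$\widetilde B\left(\tfrac{t}{\sqrt2},\tfrac{t}{\sqrt2}\right)\le\widetilde B(t\alpha,t\beta)\ \text{ for all } t>0\quad\Longrightarrow\quad A\left(\tfrac1{\sqrt2},\tfrac1{\sqrt2}\right)\ge A(\alpha,\beta).$$ Moreover, in each of these inequalities equality holds only if $\alpha=\beta=\tfrac1{\sqrt2}$: if $\widetilde B(\tfrac{t}{\sqrt2},\tfrac{t}{\sqrt2})=\widetilde B(t\alpha,t\beta)$ for some $t>0$, then $\alpha=\beta=\tfrac1{\sqrt2}$; and if $A(\tfrac1{\sqrt2},\tfrac1{\sqrt2})=A(\alpha,\beta)$, then $\alpha=\beta=\tfrac1{\sqrt2}$. -/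

import Mathlib

open MeasureTheory ENNReal

noncomputable section

/-- The standard Gaussian `g₀(t) = 2^{1/4} e^{-π t²}`. -/
def g0 (t : ℝ) : ℂ := (((2 : ℝ) ^ (1 / 4 : ℝ) * Real.exp (-Real.pi * t ^ 2) : ℝ) : ℂ)

/-- The inner product `⟨f, g⟩ = ∫ f(t) conj(g(t)) dt` (linear in the first entry). -/
def innerL2 (f g : ℝ → ℂ) : ℂ := ∫ t : ℝ, f t * starRingEnd ℂ (g t)

/-- The time-frequency shift `π(x, ω) g(t) = e^{2πiωt} g(t - x)`. -/
def timeFreqShift (z : ℝ × ℝ) (g : ℝ → ℂ) (t : ℝ) : ℂ :=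
  Complex.exp (2 * Real.pi * Complex.I * z.2 * t) * g (t - z.1)

/-- The short-time Fourier transform
`V_g f(x, ω) = ∫ f(t) conj(g(t - x)) e^{-2πiωt} dt`. -/
def stft (g f : ℝ → ℂ) (z : ℝ × ℝ) : ℂ :=
  ∫ t : ℝ, f t * starRingEnd ℂ (g (t - z.1)) * Complex.exp (-2 * Real.pi * Complex.I * z.2 * t)

/-- The separable lattice `α ℤ × β ℤ`. -/
def sepLattice (α β : ℝ) : AddSubgroup (ℝ × ℝ) :=
  (AddSubgroup.zmultiples α).prod (AddSubgroup.zmultiples β)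

/-- The adjoint lattice `(1/β) ℤ × (1/α) ℤ` of `α ℤ × β ℤ`. -/
def adjointLattice (α β : ℝ) : AddSubgroup (ℝ × ℝ) := sepLattice (1 / β) (1 / α)

/-- `A` is a lower frame bound of the Gabor system `{π(z) g | z ∈ Λ}`:
`A ‖f‖² ≤ ∑_{z ∈ Λ} |⟨f, π(z) g⟩|²` for all `f ∈ L²(ℝ)`. The sum is taken in `[0, ∞]`;
the value `A = 0` is allowed, so that the set of lower bounds is never empty. -/
def IsLowerFrameBound (g : ℝ → ℂ) (Λ : AddSubgroup (ℝ × ℝ)) (A : ℝ≥0∞) : Prop :=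
  ∀ f : ℝ → ℂ, MemLp f 2 (volume : Measure ℝ) →
    A * eLpNorm f 2 (volume : Measure ℝ) ^ 2 ≤
      ∑' z : Λ, ‖innerL2 f (timeFreqShift (z : ℝ × ℝ) g)‖ₑ ^ 2

/-- The optimal (largest) lower frame bound of the Gabor system `{π(z) g | z ∈ Λ}`;
it is `0` when the system has no positive lower frame bound. -/
def optimalLowerFrameBound (g : ℝ → ℂ) (Λ : AddSubgroup (ℝ × ℝ)) : ℝ≥0∞ :=
  sSup {A | IsLowerFrameBound g Λ A}

/-- `A(α, β)`: the optimal lower frame bound of the Gaussian Gabor system over `α ℤ × β ℤ`. -/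
def lowerBoundA (α β : ℝ) : ℝ≥0∞ := optimalLowerFrameBound g0 (sepLattice α β)

/-- The re-normalized Tolimieri and Orr bound: the sum (in `[0, ∞]`) of `|V_{g₀} g₀|`
over the adjoint lattice of `α ℤ × β ℤ`. -/
def tolimieriOrrBound (α β : ℝ) : ℝ≥0∞ :=
  ∑' z : adjointLattice α β, ‖stft g0 g0 (z : ℝ × ℝ)‖ₑ

end

/-!
Put `s = 2 α²`, so that `1 / s = 2 β²` when `α β = 1/2`. Both quantities are products of theta constants:
`B̃(t α, t β) = θ₃(r s) θ₃(r / s)` with `r = 1 / t²`, and `A(α, β) = 2 θ₄(s) θ₄(1 / s)`. Hence everything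
follows from two strict inequalities for `s ≠ 1`, namely `θ₃(r s) θ₃(r / s) > θ₃(r)²` and
`θ₄(s) θ₄(1 / s) < θ₄(1)²`. The implication in the theorem then holds because its conclusion does.

* `thetaFour_mul_lt`: Gauss's product gives `θ₄(s) = ∏ tanh (k π s / 2)`, and `log tanh` is strictly
  concave in `log s`.
* `sq_thetaThree_lt`: `log (s^{1/4} θ₃(s))` is even in `log s` by the functional equation, so it is
  enough to see strict convexity for `s ≥ 7/10`, where it holds term by term.

For the frame bound, Parseval's identity turns the sum over the lattice into the integral over
`t ∈ (0, 2 α]` of a quadratic form in the samples `a_j = f(t + 2 α j)` (`tsum_sepLattice_inner_eq`).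
Products of Gaussians being Gaussian, this form is `C(t) ∑_{j,k} e^{-π s (j - k)²} a_j conj(a_k)`
with `C = latticeGaussian α` (`hasSum_norm_sq_sample`). Only two estimates are used. At `s = 1` the form
is at least `C(t) θ₄(1) ‖a‖²` with `C(t) ≥ √2 θ₄(1)`, which gives the lower bound for the square lattice
(`isLowerFrameBound_square`). For arbitrary `s`, functions supported near `α / 2 + 2 α ℤ` with
alternating signs show that no lower bound exceeds `2 θ₄(s) θ₄(1 / s)` (`lowerFrameBound_le`).
-/

section

open HurwitzZeta ComplexConjugate Set

/-! ### Theta constants and Gauss's product -/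

/-- The Jacobi theta constant `θ₃(s) = ∑_{k ∈ ℤ} e^{-π k² s}` (for `s > 0`), as a value of Mathlib's
`cosKernel`, so that its functional equation and continuity are at hand. -/
noncomputable def thetaThree (s : ℝ) : ℝ := cosKernel 0 s

/-- The Jacobi theta constant `θ₄(s) = ∑_{k ∈ ℤ} (-1)^k e^{-π k² s}` (for `s > 0`). -/
noncomputable def thetaFour (s : ℝ) : ℝ := cosKernel ((1 / 2 : ℝ) : UnitAddCircle) s

lemma hasSum_thetaThree {s : ℝ} (hs : 0 < s) :
    HasSum (fun n : ℕ ↦ 2 * Real.exp (-Real.pi * (n + 1) ^ 2 * s)) (thetaThree s - 1) := by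
  simpa [thetaThree] using hasSum_nat_cosKernel₀ 0 hs

lemma hasSum_int_thetaThree {s : ℝ} (hs : 0 < s) :
    HasSum (fun n : ℤ ↦ Real.exp (-Real.pi * n ^ 2 * s)) (thetaThree s) := by
  simpa [thetaThree, evenKernel_eq_cosKernel_of_zero] using hasSum_int_evenKernel 0 hs

lemma hasSum_thetaFour {s : ℝ} (hs : 0 < s) :
    HasSum (fun n : ℕ ↦ 2 * (-1) ^ (n + 1) * Real.exp (-Real.pi * (n + 1) ^ 2 * s))
      (thetaFour s - 1) := by
  refine (hasSum_nat_cosKernel₀ (1 / 2) hs).congr_fun fun n ↦ ?_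
  have : 2 * Real.pi * (1 / 2) * ((n : ℝ) + 1) = ((n + 1 : ℕ) : ℝ) * Real.pi := by
    push_cast; ring
  rw [this, Real.cos_nat_mul_pi]

/-- The partial product `∏_{k=1}^n (1 - q^k) / (1 + q^k)` of Gauss's product for `θ₄`. -/
noncomputable def gaussProd (q : ℝ) (n : ℕ) : ℝ :=
  ∏ k ∈ Finset.range n, (1 - q ^ (k + 1)) / (1 + q ^ (k + 1))

lemma gaussProd_succ (q : ℝ) (n : ℕ) :
    gaussProd q (n + 1) = gaussProd q n * ((1 - q ^ (n + 1)) / (1 + q ^ (n + 1))) :=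
  Finset.prod_range_succ _ _

lemma gaussProd_pos {q : ℝ} (h0 : 0 < q) (h1 : q < 1) (n : ℕ) : 0 < gaussProd q n :=
  Finset.prod_pos fun k _ ↦ div_pos (sub_pos.2 (pow_lt_one₀ h0.le h1 k.succ_ne_zero))
    (by positivity)

lemma gaussProd_antitone {q : ℝ} (h0 : 0 < q) (h1 : q < 1) : Antitone (gaussProd q) := by
  refine antitone_nat_of_succ_le fun n ↦ ?_
  rw [gaussProd_succ]
  refine mul_le_of_le_one_right (gaussProd_pos h0 h1 n).le ?_
  rw [div_le_one (by positivity)]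
  linarith [pow_pos h0 (n + 1)]

/-- The step from `n` to `n + 1` on the right-hand side of Shanks' identity. The difference of the terms
is itself a difference in `s`, so the sum collapses. -/
lemma gauss_telescope {q : ℝ} (h0 : 0 < q) (h1 : q < 1) (n M : ℕ) :
    ∑ s ∈ Finset.range (M + 1),
      ((-1) ^ s * q ^ (s * (n + 2)) * (gaussProd q (n + 1) / gaussProd q s) * (2 / (1 + q ^ s))
        - (-1) ^ s * q ^ (s * (n + 1)) * (gaussProd q n / gaussProd q s) * (2 / (1 + q ^ s)))
      = -2 * gaussProd q n / (1 + q ^ (n + 1)) *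
        ((-1) ^ M * q ^ ((M + 1) * (n + 1)) / gaussProd q M) := by
  have hq (k : ℕ) : (1 + q ^ k) ≠ 0 := by positivity
  induction M with
  | zero =>
    have := hq (n + 1)
    have h00 : gaussProd q 0 = 1 := rfl
    rw [zero_add, Finset.sum_range_one, gaussProd_succ, h00]
    simp only [pow_zero, zero_mul, one_mul, div_one]
    generalize q ^ (n + 1) = Y at *
    field_simp
    ring
  | succ M ih =>
    rw [Finset.sum_range_succ, ih]
    have hP := (gaussProd_pos h0 h1 M).ne'
    have hM : 1 - q ^ (M + 1) ≠ 0 := (sub_pos.2 (pow_lt_one₀ h0.le h1 M.succ_ne_zero)).ne'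
    have e1 : q ^ ((M + 1) * (n + 2)) = q ^ ((M + 1) * (n + 1)) * q ^ (M + 1) := by
      rw [← pow_add]; ring_nf
    have e2 : q ^ ((M + 1 + 1) * (n + 1)) = q ^ ((M + 1) * (n + 1)) * q ^ (n + 1) := by
      rw [← pow_add]; ring_nf
    rw [e1, e2, gaussProd_succ q n, gaussProd_succ q M]
    have h3 := hq (n + 1)
    have h4 := hq (M + 1)
    generalize q ^ ((M + 1) * (n + 1)) = X
    generalize q ^ (M + 1) = Y at *
    generalize q ^ (n + 1) = Z at *
    generalize gaussProd q M = P at *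
    rw [pow_succ]
    field_simp
    ring

/-- Shanks' finite form of Gauss's identity. The term `s = 0` on the right is `gaussProd q n`, and all
others are `O(q^n)`. -/
lemma gauss_finite_identity {q : ℝ} (h0 : 0 < q) (h1 : q < 1) (n : ℕ) :
    1 + ∑ k ∈ Finset.range n, 2 * (-1) ^ (k + 1) * q ^ ((k + 1) ^ 2) =
      ∑ s ∈ Finset.range (n + 1),
        (-1) ^ s * q ^ (s * (n + 1)) * (gaussProd q n / gaussProd q s) * (2 / (1 + q ^ s)) := by
  induction n with
  | zero => simp [gaussProd]; norm_num
  | succ n ih =>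
    rw [Finset.sum_range_succ, ← add_assoc, ih, Finset.sum_range_succ _ (n + 1)]
    have := gauss_telescope h0 h1 n n
    rw [Finset.sum_sub_distrib, sub_eq_iff_eq_add] at this
    rw [show n + 1 + 1 = n + 2 from rfl, this, div_self (gaussProd_pos h0 h1 _).ne']
    have hP := (gaussProd_pos h0 h1 n).ne'
    have e1 : q ^ ((n + 1) * (n + 2)) = q ^ ((n + 1) ^ 2) * q ^ (n + 1) := by
      rw [← pow_add]; ring_nf
    have hq : (1 + q ^ (n + 1)) ≠ 0 := by positivity
    rw [e1, show (n + 1) * (n + 1) = (n + 1) ^ 2 by ring]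
    generalize q ^ ((n + 1) ^ 2) = X
    generalize q ^ (n + 1) = Y at *
    rw [pow_succ]
    field_simp
    ring_nf

/-- Gauss's product: `θ₄(s) = ∏_{k ≥ 1} (1 - q^k) / (1 + q^k)` with `q = e^{-π s}`. -/
lemma tendsto_gaussProd {s : ℝ} (hs : 0 < s) :
    Filter.Tendsto (gaussProd (Real.exp (-Real.pi * s))) Filter.atTop (nhds (thetaFour s)) := by
  set q := Real.exp (-Real.pi * s) with hq
  have h0 : 0 < q := Real.exp_pos _
  have h1 : q < 1 := Real.exp_lt_one_iff.2 (by nlinarith [Real.pi_pos])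
  have hsum : Filter.Tendsto (fun n ↦ 1 + ∑ k ∈ Finset.range n, 2 * (-1) ^ (k + 1) * q ^ ((k + 1) ^ 2))
      Filter.atTop (nhds (thetaFour s)) := by
    have := (hasSum_thetaFour hs).tendsto_sum_nat.const_add 1
    rw [add_sub_cancel] at this
    refine this.congr fun n ↦ ?_
    congr 1
    refine Finset.sum_congr rfl fun k _ ↦ ?_
    rw [hq, ← Real.exp_nat_mul]
    congr 2
    push_cast; ring
  have hb (n : ℕ) : |(1 + ∑ k ∈ Finset.range n, 2 * (-1) ^ (k + 1) * q ^ ((k + 1) ^ 2))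
      - gaussProd q n| ≤ 2 * (n * q ^ n) := by
    rw [gauss_finite_identity h0 h1, Finset.sum_range_succ']
    have : (-1) ^ 0 * q ^ (0 * (n + 1)) * (gaussProd q n / gaussProd q 0) * (2 / (1 + q ^ 0))
        = gaussProd q n := by
      simp [gaussProd]; norm_num
    rw [this, add_sub_cancel_right]
    refine (Finset.abs_sum_le_sum_abs _ _).trans ((Finset.sum_le_card_nsmul _ _ (2 * q ^ n) ?_).trans
      (by simp; linarith))
    intro k hk
    have hk' := Finset.mem_range.1 hk
    have hr : gaussProd q n / gaussProd q (k + 1) ≤ 1 :=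
      (div_le_one (gaussProd_pos h0 h1 _)).2 (gaussProd_antitone h0 h1 hk')
    have hr0 : 0 ≤ gaussProd q n / gaussProd q (k + 1) :=
      div_nonneg (gaussProd_pos h0 h1 _).le (gaussProd_pos h0 h1 _).le
    have hd : 2 / (1 + q ^ (k + 1)) ≤ 2 :=
      div_le_self two_pos.le (by linarith [pow_pos h0 (k + 1)])
    have hp : q ^ ((k + 1) * (n + 1)) ≤ q ^ n := pow_le_pow_of_le_one h0.le h1.le (by nlinarith)
    rw [abs_mul, abs_mul, abs_mul, abs_pow, abs_neg, abs_one, one_pow, one_mul,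
      abs_of_nonneg hr0, abs_of_pos (pow_pos h0 _), abs_of_pos (by positivity)]
    calc _ ≤ q ^ n * 1 * 2 := by gcongr
      _ = _ := by ring
  have hz : Filter.Tendsto (fun n : ℕ ↦ 2 * (n * q ^ n)) Filter.atTop (nhds 0) := by
    simpa using (tendsto_self_mul_const_pow_of_lt_one h0.le h1).const_mul 2
  have := hsum.sub (squeeze_zero_norm hb hz)
  simpa using this

/-- `cosh √(p² + q²) < cosh p cosh q`: the product is the mean of `cosh (p + q)` and `cosh (p - q)`,
and `x ↦ cosh √x` has a power series with positive coefficients, so it is strictly convex. -/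
lemma cosh_lt_cosh_mul_cosh {p q y : ℝ} (hp : p ≠ 0) (hq : q ≠ 0) (hy : y ^ 2 = p ^ 2 + q ^ 2) :
    Real.cosh y < Real.cosh p * Real.cosh q := by
  have h2 : Real.cosh p * Real.cosh q = (Real.cosh (p + q) + Real.cosh (p - q)) / 2 := by
    rw [Real.cosh_add, Real.cosh_sub]; ring
  rw [h2]
  have hs := ((Real.hasSum_cosh (p + q)).add (Real.hasSum_cosh (p - q))).div_const 2
  have hpt (n : ℕ) : ((p ^ 2 + q ^ 2) ^ n) ≤ ((p + q) ^ (2 * n) + (p - q) ^ (2 * n)) / 2 := by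
    have := (convexOn_pow n).2 (Set.mem_Ici.2 (sq_nonneg (p + q))) (Set.mem_Ici.2 (sq_nonneg (p - q)))
      (show (0:ℝ) ≤ 1 / 2 by norm_num) (show (0:ℝ) ≤ 1 / 2 by norm_num) (by norm_num)
    simp only [smul_eq_mul] at this
    rw [pow_mul, pow_mul]
    calc _ = (1 / 2 * (p + q) ^ 2 + 1 / 2 * (p - q) ^ 2) ^ n := by ring
      _ ≤ _ := this
      _ = _ := by ring
  refine hasSum_lt (i := 2) (fun n ↦ ?_) ?_ (Real.hasSum_cosh y) hs
  · rw [← add_div, div_right_comm, pow_mul y, hy]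
    gcongr
    exact hpt n
  · rw [← add_div, div_right_comm, pow_mul y, hy]
    gcongr
    have : 0 < p ^ 2 * q ^ 2 := by positivity
    nlinarith

lemma one_sub_exp_div (x : ℝ) :
    (1 - Real.exp (-2 * x)) / (1 + Real.exp (-2 * x)) = Real.tanh x := by
  rw [Real.tanh_eq_sinh_div_cosh, Real.sinh_eq, Real.cosh_eq]
  have : Real.exp (-2 * x) = Real.exp (-x) / Real.exp x := by rw [← Real.exp_sub]; ring_nf
  rw [this]
  have := Real.exp_pos x
  have := Real.exp_pos (-x)
  field_simp

/-- Strict concavity of `u ↦ log (tanh (e^u))`, in the form needed for the factors of Gauss's product. -/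
lemma tanh_mul_tanh_lt {x s : ℝ} (hx : 0 < x) (hs : 0 < s) (hs1 : s ≠ 1) :
    Real.tanh (x * s) * Real.tanh (x / s) < Real.tanh x ^ 2 := by
  have hne : x * s - x / s ≠ 0 := by
    intro h
    have : (s - 1) * (s + 1) = 0 := by field_simp at h; nlinarith
    rcases mul_eq_zero.1 this with h | h
    · exact hs1 (by linarith)
    · linarith
  have key := cosh_lt_cosh_mul_cosh (p := 2 * x) (q := x * s - x / s) (y := x * s + x / s)
    (by positivity) hne (by field_simp; ring)
  rw [Real.cosh_two_mul, Real.cosh_add, Real.cosh_sub] at key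
  simp only [Real.tanh_eq_sinh_div_cosh]
  have hc := Real.cosh_pos x
  have h1 := Real.cosh_pos (x * s)
  have h2 := Real.cosh_pos (x / s)
  have hq := Real.cosh_sq x
  rw [div_mul_div_comm, div_pow, div_lt_div_iff₀ (by positivity) (by positivity)]
  rw [hq] at key ⊢
  nlinarith [key]

lemma tanh_pos {x : ℝ} (hx : 0 < x) : 0 < Real.tanh x := by
  rw [Real.tanh_eq_sinh_div_cosh]
  exact div_pos (Real.sinh_pos_iff.2 hx) (Real.cosh_pos x)

lemma gaussProd_exp (s : ℝ) (n : ℕ) : gaussProd (Real.exp (-Real.pi * s)) n =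
    ∏ k ∈ Finset.range n, Real.tanh ((k + 1) * (Real.pi / 2) * s) := by
  refine Finset.prod_congr rfl fun k _ ↦ ?_
  rw [← one_sub_exp_div, ← Real.exp_nat_mul]
  have : ((k + 1 : ℕ) : ℝ) * (-Real.pi * s) = -2 * ((k + 1) * (Real.pi / 2) * s) := by
    push_cast; ring
  rw [this]

lemma exp_neg_pi_lt : Real.exp (-Real.pi) < 1 / 20 := by
  rw [Real.exp_neg, ← one_div]
  refine one_div_lt_one_div_of_lt (by norm_num) ?_
  have h1 : Real.exp 1 ^ 3 ≤ Real.exp Real.pi := by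
    rw [← Real.exp_nat_mul]; gcongr; norm_num; exact Real.pi_gt_three.le
  have h2 : (2.718 : ℝ) ^ 3 ≤ Real.exp 1 ^ 3 := by
    gcongr; linarith [Real.exp_one_gt_d9]
  exact lt_of_lt_of_le (by norm_num) (h2.trans h1)

/-- For `q < 1/20` the terms with `d ≥ 2` of `∑ d² q^{d²}` add up to at most the term `d = 1`. -/
lemma tsum_sq_mul_pow_le {q : ℝ} (h0 : 0 < q) (h1 : q < 1 / 20) :
    Summable (fun n : ℕ ↦ ((n : ℝ) + 1) ^ 2 * q ^ ((n + 1) ^ 2)) ∧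
    ∑' n : ℕ, ((n : ℝ) + 2) ^ 2 * q ^ ((n + 2) ^ 2) ≤ q := by
  have hb (n : ℕ) : ((n : ℝ) + 1) ^ 2 * q ^ ((n + 1) ^ 2) ≤ q * (1 / 2) ^ n := by
    have e : q ^ ((n + 1) ^ 2) = q * ((q ^ 2) ^ n * q ^ (n ^ 2)) := by
      rw [← pow_mul, ← pow_add, ← pow_succ']; ring_nf
    have h4 : ((n : ℝ) + 1) ≤ 2 ^ n := by
      have := one_add_mul_le_pow (show (-2 : ℝ) ≤ 1 by norm_num) n
      norm_num at this; linarith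
    have h5 : q ^ (n ^ 2) ≤ 1 := pow_le_one₀ h0.le (by linarith)
    have h6 : (q ^ 2) ^ n ≤ (1 / 8) ^ n := by gcongr; nlinarith
    calc _ ≤ (2 ^ n) ^ 2 * (q * ((1 / 8) ^ n * 1)) := by rw [e]; gcongr
      _ = q * ((2 ^ 2) * (1 / 8)) ^ n := by rw [mul_pow, pow_right_comm]; ring
      _ = _ := by norm_num
  have hg : Summable (fun n : ℕ ↦ q * (1 / 2 : ℝ) ^ n) := summable_geometric_two.mul_left q
  have hsum := Summable.of_nonneg_of_le (fun n ↦ by positivity) hb hg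
  refine ⟨hsum, ?_⟩
  have h' : ∀ n : ℕ, ((n : ℝ) + 2) ^ 2 * q ^ ((n + 2) ^ 2) ≤ q * (1 / 2) * (1 / 2) ^ n := by
    intro n
    have := hb (n + 1)
    push_cast at this
    calc _ = ((n : ℝ) + 1 + 1) ^ 2 * q ^ ((n + 1 + 1) ^ 2) := by ring_nf
      _ ≤ _ := this
      _ = _ := by ring
  have hs2 : HasSum (fun n : ℕ ↦ q * (1 / 2) * (1 / 2 : ℝ) ^ n) (q * (1 / 2) * 2) :=
    hasSum_geometric_two.mul_left _
  have := (Summable.of_nonneg_of_le (fun n ↦ by positivity) h' hs2.summable).hasSum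
  have := hasSum_le h' this hs2
  linarith

/-- If `e d` grows at most like `d² e(1)`, the first term of `∑_{d ≥ 1} (-1)^d q^{d²} e(d)` dominates the
others. This serves for both minimisations in the lower frame bound, over a circle variable and over
`ℓ²(ℤ)`. -/
lemma tsum_alternating_nonpos {q : ℝ} (h0 : 0 < q) (h1 : q < 1 / 20) {e : ℕ → ℝ}
    (he0 : ∀ d, 0 ≤ e d) (he : ∀ d, e d ≤ d ^ 2 * e 1) :
    Summable (fun n : ℕ ↦ (-1) ^ (n + 1) * q ^ ((n + 1) ^ 2) * e (n + 1)) ∧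
    ∑' n : ℕ, (-1) ^ (n + 1) * q ^ ((n + 1) ^ 2) * e (n + 1) ≤ 0 := by
  obtain ⟨hs, ht⟩ := tsum_sq_mul_pow_le h0 h1
  have hb (n : ℕ) : |(-1) ^ (n + 1) * q ^ ((n + 1) ^ 2) * e (n + 1)| ≤
      (((n : ℝ) + 1) ^ 2 * q ^ ((n + 1) ^ 2)) * e 1 := by
    rw [abs_mul, abs_mul, abs_pow, abs_neg, abs_one, one_pow, one_mul, abs_of_pos (pow_pos h0 _),
      abs_of_nonneg (he0 _)]
    have := he (n + 1)
    push_cast at this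
    calc _ ≤ q ^ ((n + 1) ^ 2) * (((n : ℝ) + 1) ^ 2 * e 1) := by gcongr
      _ = _ := by ring
  have hs' := hs.mul_right (e 1)
  have hsum : Summable (fun n : ℕ ↦ (-1) ^ (n + 1) * q ^ ((n + 1) ^ 2) * e (n + 1)) :=
    Summable.of_norm_bounded hs' hb
  refine ⟨hsum, ?_⟩
  rw [hsum.tsum_eq_zero_add]
  have h2 := (((summable_nat_add_iff 1).2 hsum)).tsum_le_tsum
    (fun n ↦ (le_abs_self _).trans (hb (n + 1))) ((summable_nat_add_iff 1).2 hs')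
  rw [tsum_mul_right] at h2
  have h3 : ∑' n : ℕ, (((n + 1 : ℕ) : ℝ) + 1) ^ 2 * q ^ ((n + 1 + 1) ^ 2) ≤ q := by
    refine le_of_eq_of_le (tsum_congr fun n ↦ ?_) ht
    push_cast; ring_nf
  have h4 := mul_le_mul_of_nonneg_right h3 (he0 1)
  norm_num at h2 ⊢
  norm_num at h4
  linarith

lemma thetaFour_one_pos : 0 < thetaFour 1 := by
  have h0 := Real.exp_pos (-Real.pi)
  have h1 := exp_neg_pi_lt
  have h := hasSum_thetaFour one_pos
  obtain ⟨hs, ht⟩ := tsum_sq_mul_pow_le h0 h1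
  have e1 (n : ℕ) : Real.exp (-Real.pi * (n + 1) ^ 2 * 1) = Real.exp (-Real.pi) ^ ((n + 1) ^ 2) := by
    rw [← Real.exp_nat_mul]; push_cast; ring_nf
  have hle : ∀ n : ℕ, -(2 * (((n : ℝ) + 1) ^ 2 * Real.exp (-Real.pi) ^ ((n + 1) ^ 2))) ≤
      2 * (-1) ^ (n + 1) * Real.exp (-Real.pi * (n + 1) ^ 2 * 1) := by
    intro n
    rw [e1]
    have hx := pow_pos h0 ((n + 1) ^ 2)
    have h2 : 1 ≤ ((n : ℝ) + 1) ^ 2 := one_le_pow₀ (by simp)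
    rcases neg_one_pow_eq_or ℝ (n + 1) with h | h <;> rw [h] <;> nlinarith
  have := hasSum_le hle (hs.hasSum.mul_left 2).neg h
  rw [hs.tsum_eq_zero_add] at this
  have h3 : ∑' n : ℕ, (((n + 1 : ℕ) : ℝ) + 1) ^ 2 * Real.exp (-Real.pi) ^ ((n + 1 + 1) ^ 2)
      ≤ Real.exp (-Real.pi) := by
    refine le_of_eq_of_le (tsum_congr fun n ↦ ?_) ht
    push_cast; ring_nf
  norm_num at this
  norm_num at h3
  linarith

/-- `s ↦ θ₄(s) θ₄(1/s)` has its strict maximum at `s = 1`: by Gauss's product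
`θ₄(s) = ∏_{k ≥ 1} tanh (k π s / 2)`, and the inequality holds factor by factor. -/
lemma thetaFour_mul_lt {s : ℝ} (hs : 0 < s) (hs1 : s ≠ 1) :
    thetaFour s * thetaFour (1 / s) < thetaFour 1 ^ 2 := by
  have hx (k : ℕ) : 0 < ((k : ℝ) + 1) * (Real.pi / 2) := by positivity
  -- the quotient of the factors `k = 1`, which keeps the inequality strict in the limit
  set ρ := Real.tanh (Real.pi / 2 * s) * Real.tanh (Real.pi / 2 / s) / Real.tanh (Real.pi / 2) ^ 2
    with hρ
  have hpi : 0 < Real.pi / 2 := by positivity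
  have hρ1 : ρ < 1 := by
    rw [hρ, div_lt_one (pow_pos (tanh_pos hpi) 2)]
    exact tanh_mul_tanh_lt hpi hs hs1
  have hfin (n : ℕ) : gaussProd (Real.exp (-Real.pi * s)) (n + 1) *
      gaussProd (Real.exp (-Real.pi * (1 / s))) (n + 1) ≤
        ρ * gaussProd (Real.exp (-Real.pi * 1)) (n + 1) ^ 2 := by
    rw [gaussProd_exp, gaussProd_exp, gaussProd_exp, ← Finset.prod_mul_distrib,
      ← Finset.prod_pow, Finset.prod_range_succ', Finset.prod_range_succ' _ n, mul_left_comm ρ]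
    have e0 : ρ * Real.tanh (((0 : ℕ) + 1) * (Real.pi / 2) * 1) ^ 2 =
        Real.tanh (((0 : ℕ) + 1) * (Real.pi / 2) * s) *
        Real.tanh (((0 : ℕ) + 1) * (Real.pi / 2) * (1 / s)) := by
      have := (tanh_pos hpi).ne'
      simp [hρ, div_eq_mul_inv]
      field_simp
    rw [e0]
    gcongr ?_ * _
    · have h1 := tanh_pos (mul_pos (hx 0) hs)
      have h2 := tanh_pos (mul_pos (hx 0) (one_div_pos.2 hs))
      exact (mul_pos h1 h2).le
    · refine Finset.prod_le_prod (fun k _ ↦ ?_) fun k _ ↦ ?_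
      · have h1 := tanh_pos (mul_pos (hx (k + 1)) hs)
        have h2 := tanh_pos (mul_pos (hx (k + 1)) (one_div_pos.2 hs))
        exact (mul_pos h1 h2).le
      · have := (tanh_mul_tanh_lt (hx (k + 1)) hs hs1).le
        rwa [mul_one_div, mul_one]
  have hl := ((tendsto_gaussProd hs).mul (tendsto_gaussProd (one_div_pos.2 hs))).comp
    (Filter.tendsto_add_atTop_nat 1)
  have hr := (((tendsto_gaussProd one_pos).pow 2).const_mul ρ).comp
    (Filter.tendsto_add_atTop_nat 1)
  have := le_of_tendsto_of_tendsto' hl hr hfin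
  nlinarith [pow_pos thetaFour_one_pos 2]

/-! ### Log-convexity of `θ₃` -/

/-- With `x = c e^u` the derivative is `-2 x / (w e^x + 2)`, and the hypothesis `H` makes it increasing. -/
lemma strictConvexOn_log_add_exp {w c v : ℝ} (hw : 0 < w) (hc : 0 < c)
    (H : ∀ x, c * Real.exp v ≤ x → 2 ≤ w * Real.exp x * (x - 1)) :
    StrictConvexOn ℝ (Set.Ici v) (fun u ↦ Real.log (w + 2 * Real.exp (-(c * Real.exp u)))) := by
  have hpos (u : ℝ) : 0 < w + 2 * Real.exp (-(c * Real.exp u)) := by positivity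
  have hd (u : ℝ) : HasDerivAt (fun u ↦ Real.log (w + 2 * Real.exp (-(c * Real.exp u))))
      (-(2 * (c * Real.exp u)) / (w * Real.exp (c * Real.exp u) + 2)) u := by
    have h1 := ((((Real.hasDerivAt_exp u).const_mul c).neg.exp.const_mul 2).const_add w).log
      (hpos u).ne'
    refine h1.congr_deriv ?_
    rw [Pi.neg_apply, Real.exp_neg]
    have := Real.exp_pos (c * Real.exp u)
    field_simp
  refine StrictMonoOn.strictConvexOn_of_deriv (convex_Ici v)
    (fun u _ ↦ (hd u).continuousAt.continuousWithinAt) ?_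
  rw [interior_Ici]
  intro u hu u' _ huu'
  rw [(hd u).deriv, (hd u').deriv]
  have hxv : c * Real.exp v ≤ c * Real.exp u := by
    have := Real.exp_le_exp.2 (Set.mem_Ioi.1 hu).le
    gcongr
  have hxy : c * Real.exp u < c * Real.exp u' := by gcongr
  have hx : 0 < c * Real.exp u := by positivity
  generalize c * Real.exp u = x at *
  generalize c * Real.exp u' = y at *
  have h1 := H x hxv
  have h2 : Real.exp x * (1 + (y - x)) < Real.exp y := by
    have := Real.add_one_lt_exp (sub_pos.2 hxy).ne'
    rw [show y = x + (y - x) by ring, Real.exp_add, ← show y = x + (y - x) by ring]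
    gcongr
    linarith
  rw [div_lt_div_iff₀ (by positivity) (by positivity)]
  have h3 : w * x * (Real.exp x * (1 + (y - x))) < w * x * Real.exp y := by gcongr
  nlinarith [mul_le_mul_of_nonneg_right h1 (sub_pos.2 hxy).le]

/-- With the constant term `1 = ∑ 2^{-k}` of `θ₃` distributed over the other terms, each term is strictly
log-convex as a function of `log s` in the range `s ≥ 7/10`. -/
lemma sq_add_exp_lt {s σ : ℝ} (hs : 0 < s) (hσ : 1 < σ) (h : 7 / 10 ≤ s / σ) (n : ℕ) :
    ((1 / 2) ^ (n + 1) + 2 * Real.exp (-Real.pi * (n + 1) ^ 2 * s)) ^ 2 <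
      ((1 / 2) ^ (n + 1) + 2 * Real.exp (-Real.pi * (n + 1) ^ 2 * (s * σ))) *
      ((1 / 2) ^ (n + 1) + 2 * Real.exp (-Real.pi * (n + 1) ^ 2 * (s / σ))) := by
  have hσ0 : 0 < σ := by linarith
  have hc : 0 < Real.pi * ((n : ℝ) + 1) ^ 2 := by positivity
  have H : ∀ x, Real.pi * ((n : ℝ) + 1) ^ 2 * Real.exp (Real.log (s / σ)) ≤ x →
      2 ≤ (1 / 2) ^ (n + 1) * Real.exp x * (x - 1) := by
    intro x hx
    rw [Real.exp_log (by positivity)] at hx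
    have hn : (1 : ℝ) ≤ (n : ℝ) + 1 := by simp
    have h1 : 2 * ((n : ℝ) + 1) ≤ x := by
      have h3 := Real.pi_gt_three
      have : 2 * ((n : ℝ) + 1) ≤ 3 * (((n : ℝ) + 1) ^ 2) * (7 / 10) := by nlinarith
      refine this.trans (le_trans ?_ hx)
      gcongr
    have h2 : (4 : ℝ) ^ (n + 1) ≤ Real.exp x := by
      have h5 : (2 : ℝ) ≤ Real.exp 1 := by linarith [Real.exp_one_gt_d9]
      calc (4 : ℝ) ^ (n + 1) = (2 ^ 2) ^ (n + 1) := by norm_num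
        _ ≤ (Real.exp 1 ^ 2) ^ (n + 1) := by gcongr
        _ = Real.exp (2 * ((n : ℝ) + 1)) := by
          rw [← pow_mul, ← Real.exp_nat_mul]; push_cast; ring_nf
        _ ≤ _ := Real.exp_le_exp.2 h1
    have h4 : (2 : ℝ) ≤ (1 / 2) ^ (n + 1) * Real.exp x := by
      calc (2 : ℝ) = 2 ^ 1 := by norm_num
        _ ≤ 2 ^ (n + 1) := pow_le_pow_right₀ (by norm_num) (by omega)
        _ = (1 / 2) ^ (n + 1) * 4 ^ (n + 1) := by rw [← mul_pow]; norm_num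
        _ ≤ _ := by gcongr
    nlinarith
  have hconv := strictConvexOn_log_add_exp (w := (1 / 2) ^ (n + 1)) (by positivity) hc H
  have hlσ : 0 < Real.log σ := Real.log_pos hσ
  have ha : Real.log (s / σ) = Real.log s - Real.log σ := Real.log_div hs.ne' hσ0.ne'
  have hb : Real.log (s * σ) = Real.log s + Real.log σ := Real.log_mul hs.ne' hσ0.ne'
  have := hconv.2 (Set.mem_Ici.2 le_rfl)
    (show Real.log (s * σ) ∈ Set.Ici (Real.log (s / σ)) by
      rw [Set.mem_Ici, ha, hb]; linarith)
    (by rw [ha, hb]; intro h; linarith) (show (0:ℝ) < 1 / 2 by norm_num)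
    (show (0:ℝ) < 1 / 2 by norm_num) (by norm_num)
  have hmid : (1 / 2 : ℝ) • Real.log (s / σ) + (1 / 2 : ℝ) • Real.log (s * σ) = Real.log s := by
    rw [ha, hb]; simp only [smul_eq_mul]; ring
  rw [hmid] at this
  simp only [smul_eq_mul] at this
  rw [Real.exp_log hs, Real.exp_log (by positivity), Real.exp_log (by positivity)] at this
  simp only [neg_mul]
  rw [← Real.log_lt_log_iff (by positivity) (by positivity), Real.log_pow,
    Real.log_mul (by positivity) (by positivity)]
  push_cast
  linarith

lemma hasSum_thetaThree_weighted {s : ℝ} (hs : 0 < s) :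
    HasSum (fun n : ℕ ↦ (1 / 2 : ℝ) ^ (n + 1) + 2 * Real.exp (-Real.pi * (n + 1) ^ 2 * s))
      (thetaThree s) := by
  have h1 : HasSum (fun n : ℕ ↦ (1 / 2 : ℝ) ^ (n + 1)) 1 := by
    have := hasSum_geometric_two.mul_right (1 / 2)
    simpa [pow_succ] using this
  simpa using h1.add (hasSum_thetaThree hs)

lemma thetaThree_pos {s : ℝ} (hs : 0 < s) : 0 < thetaThree s :=
  (hasSum_thetaThree_weighted hs).tsum_eq ▸
    (hasSum_thetaThree_weighted hs).summable.tsum_pos (fun _ ↦ by positivity) 0 (by positivity)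

/-- Strict log-convexity of `θ₃` in `log s`, in the range `s ≥ 7/10`: the Cauchy-Schwarz inequality
carries it over from the terms to the sum. -/
lemma sq_thetaThree_lt_of_le {s σ : ℝ} (hs : 0 < s) (hσ : 1 < σ) (h : 7 / 10 ≤ s / σ) :
    thetaThree s ^ 2 < thetaThree (s * σ) * thetaThree (s / σ) := by
  have hσ0 : 0 < σ := by linarith
  have hA := thetaThree_pos (mul_pos hs hσ0)
  have hB := thetaThree_pos (div_pos hs hσ0)
  set A := thetaThree (s * σ) with hAd
  set B := thetaThree (s / σ) with hBd
  set r := Real.sqrt (A * B) with hr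
  have hr0 : 0 < r := Real.sqrt_pos.2 (mul_pos hA hB)
  have hr2 : r ^ 2 = A * B := Real.sq_sqrt (mul_pos hA hB).le
  -- `2 √(a b) ≤ (r / A) a + (r / B) b`, with weights chosen so that the sum over `n` is `2 r`
  have hsum := ((hasSum_thetaThree_weighted (mul_pos hs hσ0)).mul_left (r / (2 * A))).add
    ((hasSum_thetaThree_weighted (div_pos hs hσ0)).mul_left (r / (2 * B)))
  have e : r / (2 * A) * A + r / (2 * B) * B = r := by field_simp; ring
  rw [← hAd, ← hBd, e] at hsum
  have hpt (n : ℕ) : (1 / 2 : ℝ) ^ (n + 1) + 2 * Real.exp (-Real.pi * (n + 1) ^ 2 * s) <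
      r / (2 * A) * ((1 / 2) ^ (n + 1) + 2 * Real.exp (-Real.pi * (n + 1) ^ 2 * (s * σ))) +
      r / (2 * B) * ((1 / 2) ^ (n + 1) + 2 * Real.exp (-Real.pi * (n + 1) ^ 2 * (s / σ))) := by
    have h1 := sq_add_exp_lt hs hσ h n
    set a := (1 / 2 : ℝ) ^ (n + 1) + 2 * Real.exp (-Real.pi * (n + 1) ^ 2 * (s * σ))
    set b := (1 / 2 : ℝ) ^ (n + 1) + 2 * Real.exp (-Real.pi * (n + 1) ^ 2 * (s / σ))
    refine lt_of_pow_lt_pow_left₀ 2 (by positivity) (h1.trans_le ?_)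
    have e2 : a * b = 4 * (r / (2 * A) * a) * (r / (2 * B) * b) := by
      field_simp
      rw [hr2]; ring
    rw [e2]
    nlinarith [sq_nonneg (r / (2 * A) * a - r / (2 * B) * b)]
  have := hasSum_lt (i := 0) (fun n ↦ (hpt n).le) (hpt 0) (hasSum_thetaThree_weighted hs) hsum
  rw [← hr2]
  exact pow_lt_pow_left₀ this (thetaThree_pos hs).le two_ne_zero

lemma thetaThree_inv {s : ℝ} (hs : 0 < s) : thetaThree (1 / s) = Real.sqrt s * thetaThree s := by
  have := evenKernel_functional_equation 0 s
  rw [evenKernel_eq_cosKernel_of_zero, ← Real.sqrt_eq_rpow] at this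
  have hq := Real.sqrt_pos.2 hs
  unfold thetaThree
  rw [this]
  field_simp

/-- A continuous function that is strictly midpoint convex near each point is strictly midpoint convex:
otherwise its difference with a chord has an interior maximum. -/
lemma strict_midpoint_convex_of_local {h : ℝ → ℝ} (hc : Continuous h)
    (hl : ∀ z, ∃ ε > 0, ∀ η, 0 < η → η < ε → 2 * h z < h (z + η) + h (z - η))
    (a : ℝ) {b : ℝ} (hb : 0 < b) : 2 * h a < h (a + b) + h (a - b) := by
  by_contra! hcon
  set g : ℝ → ℝ := fun x ↦ h x - (h (a + b) - h (a - b)) / (2 * b) * (x - a) with hg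
  have g1 : g (a + b) = (h (a + b) + h (a - b)) / 2 := by simp only [hg]; field_simp; ring
  have g2 : g (a - b) = (h (a + b) + h (a - b)) / 2 := by simp only [hg]; field_simp; ring
  have ga : g a = h a := by simp [hg]
  have hgc : Continuous g := by fun_prop
  -- `g` takes equal values at the endpoints, at most its value at `a`
  obtain ⟨z, hz, hmax⟩ : ∃ z ∈ Set.Ioo (a - b) (a + b),
      ∀ y ∈ Set.Icc (a - b) (a + b), g y ≤ g z := by
    obtain ⟨z, hz, hmax⟩ := isCompact_Icc.exists_isMaxOn
      (Set.nonempty_Icc.2 (show a - b ≤ a + b by linarith)) hgc.continuousOn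
    by_cases h1 : z ∈ Set.Ioo (a - b) (a + b)
    · exact ⟨z, h1, fun y hy ↦ hmax hy⟩
    · have hga : g z ≤ g a := by
        have : z = a - b ∨ z = a + b := by
          rcases hz.1.eq_or_lt with h2 | h2
          · exact .inl h2.symm
          · rcases hz.2.eq_or_lt with h3 | h3
            · exact .inr h3
            · exact (h1 ⟨h2, h3⟩).elim
        rcases this with h2 | h2 <;> subst h2 <;> linarith
      exact ⟨a, ⟨by linarith, by linarith⟩, fun y hy ↦ le_trans (hmax hy) hga⟩
  obtain ⟨ε, hε, hloc⟩ := hl z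
  set η := min (ε / 2) (min (z - (a - b)) (a + b - z))
  have hη : 0 < η := lt_min (by linarith) (lt_min (by linarith [hz.1]) (by linarith [hz.2]))
  have hη1 : η < ε := (min_le_left _ _).trans_lt (by linarith)
  have hη2 : η ≤ z - (a - b) := (min_le_right _ _).trans (min_le_left _ _)
  have hη3 : η ≤ a + b - z := (min_le_right _ _).trans (min_le_right _ _)
  have k1 := hmax (z + η) ⟨by linarith, by linarith⟩
  have k2 := hmax (z - η) ⟨by linarith, by linarith⟩
  have k3 := hloc η hη hη1
  simp only [hg] at k1 k2
  nlinarith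

/-- `u ↦ log (s^{1/4} θ₃(s))` at `s = e^u`. The factor `s^{1/4}` makes it an even function. -/
noncomputable def logThetaThree (u : ℝ) : ℝ := u / 4 + Real.log (thetaThree (Real.exp u))

lemma logThetaThree_neg (u : ℝ) : logThetaThree (-u) = logThetaThree u := by
  unfold logThetaThree
  rw [Real.exp_neg, ← one_div, thetaThree_inv (Real.exp_pos u),
    Real.log_mul (Real.sqrt_pos.2 (Real.exp_pos u)).ne' (thetaThree_pos (Real.exp_pos u)).ne',
    Real.log_sqrt (Real.exp_pos u).le, Real.log_exp]
  ring

lemma continuous_logThetaThree : Continuous logThetaThree := by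
  unfold logThetaThree
  have h1 : Continuous fun u ↦ thetaThree (Real.exp u) :=
    (continuousOn_cosKernel 0).comp_continuous Real.continuous_exp fun u ↦ Real.exp_pos u
  exact (by fun_prop : Continuous fun u : ℝ ↦ u / 4).add
    (h1.log fun u ↦ (thetaThree_pos (Real.exp_pos u)).ne')

lemma logThetaThree_local_of_nonneg {u : ℝ} (hu : 0 ≤ u) {η : ℝ} (hη : 0 < η) (hη1 : η < 3 / 10) :
    2 * logThetaThree u < logThetaThree (u + η) + logThetaThree (u - η) := by
  have h1 : 7 / 10 ≤ Real.exp u / Real.exp η := by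
    rw [← Real.exp_sub]
    linarith [Real.add_one_le_exp (u - η)]
  have := sq_thetaThree_lt_of_le (Real.exp_pos u) (Real.one_lt_exp_iff.2 hη) h1
  rw [← Real.exp_sub, ← Real.exp_add] at this
  have p := thetaThree_pos (Real.exp_pos u)
  have p1 := thetaThree_pos (Real.exp_pos (u + η))
  have p2 := thetaThree_pos (Real.exp_pos (u - η))
  have := Real.log_lt_log (by positivity) this
  rw [Real.log_pow, Real.log_mul p1.ne' p2.ne'] at this
  push_cast at this
  unfold logThetaThree
  linarith

/-- Strict log-convexity of `θ₃` in `log s`. The range `s ≥ 7/10` reaches below the symmetry point `s = 1`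
of the functional equation, so evenness gives local convexity everywhere. -/
lemma sq_thetaThree_lt {r s : ℝ} (hr : 0 < r) (hs : 0 < s) (hs1 : s ≠ 1) :
    thetaThree r ^ 2 < thetaThree (r * s) * thetaThree (r * (1 / s)) := by
  wlog h : 1 < s generalizing s
  · have := this (one_div_pos.2 hs) (by rwa [ne_eq, div_eq_one_iff_eq hs.ne', eq_comm])
      ((one_lt_div hs).2 (lt_of_le_of_ne (not_lt.1 h) hs1))
    rwa [one_div_one_div, mul_comm (thetaThree _)] at this
  have key := strict_midpoint_convex_of_local continuous_logThetaThree (fun z ↦ by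
    refine ⟨3 / 10, by norm_num, fun η h1 h2 ↦ ?_⟩
    rcases le_total 0 z with hz | hz
    · exact logThetaThree_local_of_nonneg hz h1 h2
    · have := logThetaThree_local_of_nonneg (neg_nonneg.2 hz) h1 h2
      rw [← logThetaThree_neg z, ← logThetaThree_neg (z + η), ← logThetaThree_neg (z - η)]
      rw [show -(z + η) = -z - η by ring, show -(z - η) = -z + η by ring]
      linarith) (Real.log r) (Real.log_pos h)
  unfold logThetaThree at key
  rw [Real.exp_add, Real.exp_sub, Real.exp_log hr, Real.exp_log hs] at key
  have p := thetaThree_pos hr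
  have p1 := thetaThree_pos (mul_pos hr hs)
  have p2 := thetaThree_pos (div_pos hr hs)
  rw [mul_one_div, ← Real.log_lt_log_iff (by positivity) (by positivity), Real.log_pow,
    Real.log_mul p1.ne' p2.ne']
  push_cast
  linarith

/-! ### The minimum of the heat kernel on the circle -/

lemma one_sub_cos_nat_mul_le (n : ℕ) (x : ℝ) :
    1 - Real.cos (n * x) ≤ n ^ 2 * (1 - Real.cos x) := by
  have h (y : ℝ) : 1 - Real.cos y = 2 * Real.sin (y / 2) ^ 2 := by
    have := Real.cos_sq' (y / 2)
    have h2 := Real.cos_two_mul (y / 2)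
    rw [mul_div_cancel₀ _ two_ne_zero] at h2
    linarith
  have hs : |Real.sin (n * (x / 2))| ≤ n * |Real.sin (x / 2)| := by
    induction n with
    | zero => simp
    | succ n ih =>
      push_cast
      rw [add_mul, one_mul, Real.sin_add]
      refine (abs_add_le _ _).trans ?_
      rw [abs_mul, abs_mul]
      have h1 := Real.abs_cos_le_one (x / 2)
      have h2 := Real.abs_cos_le_one (n * (x / 2))
      nlinarith [abs_nonneg (Real.sin (n * (x / 2))), abs_nonneg (Real.sin (x / 2))]
  rw [h, h, mul_div_assoc, ← sq_abs, ← sq_abs (Real.sin (x / 2))]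
  have := pow_le_pow_left₀ (abs_nonneg _) hs 2
  rw [mul_pow] at this
  linarith

/-- `x ↦ ∑ₙ e^{2πinx} e^{-π n²}` is smallest at `x = 1/2`. -/
lemma thetaFour_one_le_cosKernel (x : ℝ) : thetaFour 1 ≤ cosKernel (x : UnitAddCircle) 1 := by
  -- shift by `1/2`, so that `cos (2 π x d) = (-1)^d cos (d v)`
  set v := 2 * Real.pi * x - Real.pi with hv
  have e1 (n : ℕ) : Real.exp (-Real.pi * (n + 1) ^ 2 * 1) = Real.exp (-Real.pi) ^ ((n + 1) ^ 2) := by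
    rw [← Real.exp_nat_mul]; push_cast; ring_nf
  obtain ⟨hs, ht⟩ := tsum_alternating_nonpos (Real.exp_pos (-Real.pi)) exp_neg_pi_lt
    (e := fun d ↦ 1 - Real.cos (d * v)) (fun d ↦ by simpa using Real.cos_le_one _)
    (fun d ↦ by simpa using one_sub_cos_nat_mul_le d v)
  have h := (hasSum_nat_cosKernel₀ x one_pos).sub (hasSum_thetaFour one_pos)
  have h2 := hs.hasSum.mul_left (-2)
  have : cosKernel (x : UnitAddCircle) 1 - 1 - (thetaFour 1 - 1) = -2 * ∑' n : ℕ, (-1) ^ (n + 1) *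
      Real.exp (-Real.pi) ^ ((n + 1) ^ 2) * (1 - Real.cos ((n + 1 : ℕ) * v)) := by
    refine h.unique (h2.congr_fun fun n ↦ ?_)
    rw [e1]
    have : Real.cos (2 * Real.pi * x * (n + 1)) = (-1) ^ (n + 1) * Real.cos ((n + 1 : ℕ) * v) := by
      rw [← Real.cos_add_nat_mul_pi, hv]
      congr 1
      push_cast; ring
    rw [this]
    ring
  linarith

/-! ### The Tolimieri-Orr bound -/

/-- The parametrisation of `α ℤ × β ℤ` by `ℤ × ℤ`. -/
noncomputable def sepLatticeEquiv {α β : ℝ} (hα : α ≠ 0) (hβ : β ≠ 0) :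
    ℤ × ℤ ≃ sepLattice α β :=
  Equiv.ofBijective (fun p ↦ ⟨(p.1 * α, p.2 * β),
    ⟨AddSubgroup.mem_zmultiples_iff.2 ⟨p.1, by simp⟩,
      AddSubgroup.mem_zmultiples_iff.2 ⟨p.2, by simp⟩⟩⟩) <| by
    constructor
    · rintro ⟨m, n⟩ ⟨m', n'⟩ h
      simpa [hα, hβ] using congrArg Subtype.val h
    · rintro ⟨⟨x, y⟩, hx, hy⟩
      obtain ⟨m, rfl⟩ := AddSubgroup.mem_zmultiples_iff.1 hx
      obtain ⟨n, rfl⟩ := AddSubgroup.mem_zmultiples_iff.1 hy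
      exact ⟨(m, n), by simp⟩

lemma tsum_sepLattice {α β : ℝ} (hα : α ≠ 0) (hβ : β ≠ 0) (F : ℝ × ℝ → ℝ≥0∞) :
    ∑' z : sepLattice α β, F z = ∑' (m : ℤ) (n : ℤ), F (m * α, n * β) := by
  rw [← (sepLatticeEquiv hα hβ).tsum_eq, ENNReal.tsum_prod']
  rfl

lemma two_rpow_quarter_sq : ((2 : ℝ) ^ (1 / 4 : ℝ)) * (2 : ℝ) ^ (1 / 4 : ℝ) = Real.sqrt 2 := by
  rw [← Real.rpow_add two_pos, Real.sqrt_eq_rpow]; norm_num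

lemma g0_mul_g0 (x y : ℝ) : g0 x * g0 y =
    ((Real.sqrt 2 * Real.exp (-Real.pi * (x ^ 2 + y ^ 2)) : ℝ) : ℂ) := by
  unfold g0
  rw [← Complex.ofReal_mul, mul_mul_mul_comm, two_rpow_quarter_sq, ← Real.exp_add]
  congr 3; ring

lemma conj_g0 (x : ℝ) : starRingEnd ℂ (g0 x) = g0 x := Complex.conj_ofReal _

lemma enorm_stft_g0 (x ω : ℝ) : ‖stft g0 g0 (x, ω)‖ₑ =
    ENNReal.ofReal (Real.exp (-Real.pi * (x ^ 2 / 2)) * Real.exp (-Real.pi * (ω ^ 2 / 2))) := by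
  have h1 : stft g0 g0 (x, ω) = ∫ t : ℝ, (Real.sqrt 2 : ℂ) *
      Complex.exp (-(2 * Real.pi) * t ^ 2 + (2 * Real.pi * x - 2 * Real.pi * Complex.I * ω) * t
        + (-Real.pi * x ^ 2)) := by
    refine integral_congr_ae (.of_forall fun t ↦ ?_)
    simp only [conj_g0, g0_mul_g0]
    push_cast
    rw [mul_assoc, ← Complex.exp_add]
    congr 2
    ring
  have hre : (-(2 * Real.pi) : ℂ).re < 0 := by simp [Real.pi_pos]
  rw [h1, integral_const_mul, integral_cexp_quadratic hre, ← ofReal_norm]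
  congr 1
  have hpi := Real.pi_ne_zero
  have hpi' : (Real.pi : ℂ) ≠ 0 := Complex.ofReal_ne_zero.2 hpi
  have e1 : (Real.pi / -(-(2 * Real.pi)) : ℂ) = ((1 / 2 : ℝ) : ℂ) := by
    push_cast; field_simp
  have e2 : (-Real.pi * x ^ 2 - (2 * Real.pi * x - 2 * Real.pi * Complex.I * ω) ^ 2 /
      (4 * -(2 * Real.pi)) : ℂ) =
      ((-Real.pi * (x ^ 2 / 2) + -Real.pi * (ω ^ 2 / 2) : ℝ) : ℂ) +
        ((-Real.pi * x * ω : ℝ) : ℂ) * Complex.I := by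
    have hI := Complex.I_sq
    push_cast
    field_simp
    ring_nf
    rw [hI]; ring
  rw [e1, e2, Complex.exp_add, norm_mul, norm_mul, norm_mul, Complex.norm_exp_ofReal_mul_I,
    Complex.norm_exp_ofReal, Real.exp_add, mul_one, show (1 / 2 : ℂ) = ((1 / 2 : ℝ) : ℂ) by simp,
    ← Complex.ofReal_cpow (by norm_num), Complex.norm_real, Complex.norm_real,
    ← Real.sqrt_eq_rpow, Real.norm_of_nonneg (Real.sqrt_nonneg _),
    Real.norm_of_nonneg (Real.sqrt_nonneg _), ← mul_assoc, ← Real.sqrt_mul (by norm_num)]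
  norm_num

lemma tolimieriOrrBound_eq {α β : ℝ} (hα : 0 < α) (hβ : 0 < β) :
    tolimieriOrrBound α β =
      ENNReal.ofReal (thetaThree (1 / (2 * β ^ 2)) * thetaThree (1 / (2 * α ^ 2))) := by
  unfold tolimieriOrrBound adjointLattice
  have h (a : ℝ) (ha : 0 < a) : ∑' m : ℤ, ENNReal.ofReal (Real.exp (-Real.pi * ((m * (1 / a)) ^ 2 / 2)))
      = ENNReal.ofReal (thetaThree (1 / (2 * a ^ 2))) := by
    have := hasSum_int_thetaThree (s := 1 / (2 * a ^ 2)) (by positivity)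
    rw [← this.tsum_eq, ENNReal.ofReal_tsum_of_nonneg (fun _ ↦ (Real.exp_pos _).le) this.summable]
    refine tsum_congr fun m ↦ ?_
    congr 2
    field_simp
  rw [tsum_sepLattice (one_div_pos.2 hβ).ne' (one_div_pos.2 hα).ne' (fun z ↦ ‖stft g0 g0 z‖ₑ),
    ENNReal.ofReal_mul (thetaThree_pos (by positivity)).le, ← h α hα, ← h β hβ]
  simp_rw [enorm_stft_g0, ENNReal.ofReal_mul (Real.exp_pos _).le, ENNReal.tsum_mul_left,
    ENNReal.tsum_mul_right]

/-! ### Gaussian samples of an `ℓ²` sequence -/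

/-- The autocorrelation `∑ⱼ a_j conj(a_{j+d})` of a sequence at lag `d`. -/
noncomputable def autocorr (a : ℤ → ℂ) (d : ℤ) : ℂ := ∑' j, a j * conj (a (j + d))

/-- The energy `∑ⱼ |a_j - (-1)^d a_{j+d}|²`, which is the squared `ℓ²` norm of the difference at lag `d`
of the modulated sequence `(-1)^j a_j`. -/
noncomputable def altDiff (a : ℤ → ℂ) (d : ℕ) : ℝ := ∑' j, ‖a j - (-1) ^ d * a (j + d)‖ ^ 2

lemma summable_shift {a : ℤ → ℂ} (ha : Summable fun j ↦ ‖a j‖ ^ 2)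
    (d : ℤ) : Summable fun j ↦ ‖a (j + d)‖ ^ 2 :=
  (Equiv.addRight d).summable_iff.2 ha

lemma tsum_shift (a : ℤ → ℂ) (d : ℤ) : ∑' j, ‖a (j + d)‖ ^ 2 = ∑' j, ‖a j‖ ^ 2 :=
  (Equiv.addRight d).tsum_eq (fun j ↦ ‖a j‖ ^ 2)

lemma summable_norm_mul_shift {a : ℤ → ℂ} (ha : Summable fun j ↦ ‖a j‖ ^ 2)
    (d : ℤ) : Summable fun j ↦ ‖a j‖ * ‖a (j + d)‖ :=
  Summable.of_nonneg_of_le (fun _ ↦ by positivity)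
    (fun j ↦ by nlinarith [sq_nonneg (‖a j‖ - ‖a (j + d)‖), sq_nonneg ‖a j‖, sq_nonneg ‖a (j + d)‖])
    (ha.add (summable_shift ha d))

lemma tsum_norm_mul_shift_le {a : ℤ → ℂ} (ha : Summable fun j ↦ ‖a j‖ ^ 2)
    (d : ℤ) : ∑' j, ‖a j‖ * ‖a (j + d)‖ ≤ ∑' j, ‖a j‖ ^ 2 := by
  have h := ((ha.add (summable_shift ha d)).mul_left (1 / 2))
  refine ((summable_norm_mul_shift ha d).tsum_le_tsum (fun j ↦ ?_) h).trans_eq ?_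
  · nlinarith [sq_nonneg (‖a j‖ - ‖a (j + d)‖)]
  · rw [tsum_mul_left, ha.tsum_add (summable_shift ha d), tsum_shift a]; ring

lemma summable_autocorr {a : ℤ → ℂ} (ha : Summable fun j ↦ ‖a j‖ ^ 2)
    (d : ℤ) : Summable fun j ↦ a j * conj (a (j + d)) :=
  .of_norm <| by simpa using summable_norm_mul_shift ha d

lemma autocorr_re_neg (a : ℤ → ℂ) (d : ℤ) : (autocorr a (-d)).re = (autocorr a d).re := by
  unfold autocorr
  rw [← (Equiv.addRight d).tsum_eq, ← Complex.conj_re, Complex.conj_tsum]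
  congr 2 with j
  simp [mul_comm]

lemma altDiff_term_le (a : ℤ → ℂ) (n : ℕ) (j : ℤ) : ‖a j - (-1) ^ n * a (j + n)‖ ^ 2 ≤
    2 * (‖a j‖ ^ 2 + ‖a (j + n)‖ ^ 2) := by
  have := norm_sub_le (a j) ((-1) ^ n * a (j + n))
  rw [norm_mul, norm_pow, norm_neg, norm_one, one_pow, one_mul] at this
  nlinarith [norm_nonneg (a j - (-1) ^ n * a (j + n)), sq_nonneg (‖a j‖ - ‖a (j + n)‖)]

lemma summable_altDiff {a : ℤ → ℂ} (ha : Summable fun j ↦ ‖a j‖ ^ 2)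
    (n : ℕ) : Summable fun j ↦ ‖a j - (-1) ^ n * a (j + n)‖ ^ 2 :=
  .of_nonneg_of_le (fun _ ↦ by positivity) (altDiff_term_le a n)
    ((ha.add (summable_shift ha n)).mul_left 2)

lemma autocorr_re {a : ℤ → ℂ} (ha : Summable fun j ↦ ‖a j‖ ^ 2)
    (n : ℕ) :
    (autocorr a n).re = (-1) ^ n * (∑' j, ‖a j‖ ^ 2 - altDiff a n / 2) := by
  have h4 : ((-1 : ℝ) ^ n) * (-1) ^ n = 1 := by rw [← mul_pow]; norm_num
  have h1 : HasSum (fun j ↦ (a j * conj (a (j + n))).re) (autocorr a n).re :=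
    Complex.hasSum_re (summable_autocorr ha n).hasSum
  have h2 := ((ha.hasSum.add (summable_shift ha n).hasSum).sub (h1.mul_left (2 * (-1) ^ n)))
  rw [tsum_shift a] at h2
  have h3 : altDiff a n = _ := (summable_altDiff ha n).hasSum.unique
    (h2.congr_fun fun j ↦ by
      have hε : ((-1 : ℂ) ^ n) = (((-1 : ℝ) ^ n : ℝ) : ℂ) := by push_cast; rfl
      rw [Complex.sq_norm, Complex.sq_norm, Complex.sq_norm, Complex.normSq_sub, hε,
        Complex.normSq_mul, Complex.normSq_ofReal, map_mul, Complex.conj_ofReal, mul_left_comm,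
        Complex.re_ofReal_mul, h4]
      ring)
  rw [h3]
  linear_combination (-(autocorr a n).re) * h4

lemma altDiff_nonneg (a : ℤ → ℂ) (n : ℕ) : 0 ≤ altDiff a n := tsum_nonneg fun _ ↦ by positivity

/-- The triangle inequality `‖(1 - V^d) a‖ ≤ d ‖(1 - V) a‖` in `ℓ²(ℤ)`, for the isometry
`(V a)_j = -a_{j+1}`. -/
lemma altDiff_le {a : ℤ → ℂ} (ha : Summable fun j ↦ ‖a j‖ ^ 2)
    (n : ℕ) : altDiff a n ≤ n ^ 2 * altDiff a 1 := by
  induction n with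
  | zero => simp [altDiff]
  | succ n ih =>
    rcases Nat.eq_zero_or_pos n with rfl | hn
    · simp
    have hn' : (0 : ℝ) < n := by exact_mod_cast hn
    have hsh : Summable fun j ↦ ‖a (j + n) - (-1) ^ 1 * a (j + n + (1 : ℕ))‖ ^ 2 :=
      (Equiv.addRight (n : ℤ)).summable_iff.2 (summable_altDiff ha 1)
    have hsh' : ∑' j, ‖a (j + n) - (-1) ^ 1 * a (j + n + (1 : ℕ))‖ ^ 2 = altDiff a 1 :=
      (Equiv.addRight (n : ℤ)).tsum_eq (fun j ↦ ‖a j - (-1) ^ 1 * a (j + (1 : ℕ))‖ ^ 2)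
    have key : altDiff a (n + 1) ≤ (1 + 1 / n) * altDiff a n + (1 + n) * altDiff a 1 := by
      rw [← hsh']
      unfold altDiff
      rw [← tsum_mul_left, ← tsum_mul_left, ← ((summable_altDiff ha n).mul_left _).tsum_add
        (hsh.mul_left _)]
      refine (summable_altDiff ha (n + 1)).tsum_le_tsum (fun j ↦ ?_)
        (((summable_altDiff ha n).mul_left _).add (hsh.mul_left _))
      have e : a j - (-1) ^ (n + 1) * a (j + (n + 1 : ℕ)) = (a j - (-1) ^ n * a (j + n)) +
          (-1) ^ n * (a (j + n) - (-1) ^ 1 * a (j + n + (1 : ℕ))) := by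
        push_cast
        rw [add_assoc j]
        ring
      have h1 := norm_add_le (a j - (-1) ^ n * a (j + n))
        ((-1) ^ n * (a (j + n) - (-1) ^ 1 * a (j + n + (1 : ℕ))))
      rw [← e, norm_mul ((-1) ^ n), norm_pow, norm_neg, norm_one, one_pow, one_mul] at h1
      set x := ‖a j - (-1) ^ n * a (j + n)‖
      set y := ‖a (j + n) - (-1) ^ 1 * a (j + n + (1 : ℕ))‖
      have h2 := pow_le_pow_left₀ (norm_nonneg _) h1 2
      refine h2.trans ?_
      -- `(x + y)² ≤ (1 + 1/n) x² + (1 + n) y²`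
      have h3 : 0 ≤ (x - n * y) ^ 2 / n := by positivity
      have h4 : (x - n * y) ^ 2 / n = 1 / n * x ^ 2 - 2 * x * y + n * y ^ 2 := by
        field_simp; ring
      nlinarith
    refine key.trans ?_
    have : (1 + 1 / (n : ℝ)) * altDiff a n ≤ (1 + 1 / n) * (n ^ 2 * altDiff a 1) := by gcongr
    refine (add_le_add_left this _).trans_eq ?_
    push_cast
    field_simp
    ring

lemma summable_sq_mul_exp {s : ℝ} (hs : 0 < s) :
    Summable fun n : ℕ ↦ ((n : ℝ) + 1) ^ 2 * Real.exp (-Real.pi * (n + 1) ^ 2 * s) := by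
  have h0 := Real.exp_pos (-Real.pi * s)
  have h1 : Real.exp (-Real.pi * s) < 1 := Real.exp_lt_one_iff.2 (by nlinarith [Real.pi_pos])
  have hg : Summable fun n : ℕ ↦ (n : ℝ) ^ 2 * Real.exp (-Real.pi * s) ^ n :=
    summable_pow_mul_geometric_of_norm_lt_one 2 (by rwa [Real.norm_of_nonneg h0.le])
  have h := (summable_nat_add_iff 1).2 hg
  refine Summable.of_nonneg_of_le (fun n ↦ by positivity) (fun n ↦ ?_) h
  push_cast
  rw [← Real.exp_nat_mul]
  refine mul_le_mul_of_nonneg_left (Real.exp_le_exp.2 ?_) (by positivity)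
  have : ((n : ℝ) + 1) ≤ (n + 1) ^ 2 := by nlinarith [n.cast_nonneg (α := ℝ)]
  have := mul_le_mul_of_nonneg_right this (mul_pos Real.pi_pos hs).le
  push_cast
  linarith

/-- The quadratic form on `ℓ²(ℤ)` of the Toeplitz matrix `e^{-π s (j - k)²}`, split into its
infimum `θ₄(s) ‖a‖²`, approached along alternating sequences, and a remainder in the energies
`altDiff`. -/
lemma hasSum_exp_mul_autocorr {a : ℤ → ℂ} (ha : Summable fun j ↦ ‖a j‖ ^ 2) {s : ℝ} (hs : 0 < s) :
    HasSum (fun d : ℤ ↦ Real.exp (-Real.pi * d ^ 2 * s) * (autocorr a d).re)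
      (thetaFour s * ∑' j, ‖a j‖ ^ 2 - ∑' n : ℕ, (-1) ^ (n + 1) *
        Real.exp (-Real.pi * (n + 1) ^ 2 * s) * altDiff a (n + 1)) := by
  have hb (d : ℤ) : |(autocorr a d).re| ≤ ∑' j, ‖a j‖ ^ 2 := by
    refine (Complex.abs_re_le_norm _).trans ?_
    refine (norm_tsum_le_tsum_norm ?_).trans ?_
    · simpa using summable_norm_mul_shift ha d
    · simpa using tsum_norm_mul_shift_le ha d
  have hsum : Summable (fun d : ℤ ↦ Real.exp (-Real.pi * d ^ 2 * s) * (autocorr a d).re) := by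
    refine Summable.of_norm_bounded ((hasSum_int_thetaThree hs).summable.mul_right
      (∑' j, ‖a j‖ ^ 2)) fun d ↦ ?_
    rw [norm_mul, Real.norm_of_nonneg (Real.exp_pos _).le]
    exact mul_le_mul_of_nonneg_left (hb d) (Real.exp_pos _).le
  have hsE : Summable fun n : ℕ ↦ (-1) ^ (n + 1) *
        Real.exp (-Real.pi * (n + 1) ^ 2 * s) * altDiff a (n + 1) := by
    refine Summable.of_norm_bounded ((summable_sq_mul_exp hs).mul_right (altDiff a 1)) fun n ↦ ?_
    rw [norm_mul, norm_mul, norm_pow, norm_neg, norm_one, one_pow, one_mul,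
      Real.norm_of_nonneg (Real.exp_pos _).le, Real.norm_of_nonneg (altDiff_nonneg a _)]
    have := altDiff_le ha (n + 1)
    push_cast at this
    calc _ ≤ Real.exp (-Real.pi * (n + 1) ^ 2 * s) * (((n : ℝ) + 1) ^ 2 * altDiff a 1) := by gcongr
      _ = _ := by ring
  have h1 := hsum.hasSum.nat_add_neg
  rw [← hasSum_nat_add_iff' 1] at h1
  have h2 := ((hasSum_thetaFour hs).mul_right (∑' j, ‖a j‖ ^ 2)).sub hsE.hasSum
  have h3 := h1.unique (h2.congr_fun fun n ↦ ?_)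
  · have h0 : (autocorr a 0).re = ∑' j, ‖a j‖ ^ 2 := by
      simpa [altDiff] using autocorr_re ha 0
    have h5 : ∑ i ∈ Finset.range 1,
        (Real.exp (-Real.pi * ((i : ℕ) : ℤ) ^ 2 * s) * (autocorr a (i : ℕ)).re +
          Real.exp (-Real.pi * ((-(i : ℤ) : ℤ) : ℝ) ^ 2 * s) * (autocorr a (-(i : ℕ))).re) =
        2 * ∑' j, ‖a j‖ ^ 2 := by
      simp [h0]; ring
    rw [h5] at h3
    convert hsum.hasSum using 1
    simp only [Int.cast_zero, ne_eq, OfNat.ofNat_ne_zero, not_false_eq_true, zero_pow, mul_zero,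
      zero_mul, Real.exp_zero, one_mul, h0] at h3
    linarith
  · have e1 := autocorr_re ha (n + 1)
    rw [autocorr_re_neg a, e1]
    push_cast
    rw [neg_sq]
    ring

/-- The periodisation `√2 ∑ₖ e^{-2π (t + α k)²}` of `|g₀|²` with period `α`. -/
noncomputable def latticeGaussian (α t : ℝ) : ℝ :=
  Real.sqrt 2 * ∑' k : ℤ, Real.exp (-(2 * Real.pi) * (t + α * k) ^ 2)

lemma hasSum_exp_evenKernel {α : ℝ} (hα : 0 < α) (t : ℝ) :
    HasSum (fun k : ℤ ↦ Real.exp (-(2 * Real.pi) * (t + α * k) ^ 2))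
      (HurwitzZeta.evenKernel ((t / α : ℝ) : UnitAddCircle) (2 * α ^ 2)) := by
  refine (HurwitzZeta.hasSum_int_evenKernel (t / α) (by positivity)).congr_fun fun k ↦ ?_
  congr 1
  field_simp
  ring

lemma norm_sq_g0 (x : ℝ) : ‖g0 x‖ ^ 2 = Real.sqrt 2 * Real.exp (-(2 * Real.pi) * x ^ 2) := by
  have h := g0_mul_g0 x x
  have h2 : (0 : ℝ) ≤ Real.sqrt 2 * Real.exp (-Real.pi * (x ^ 2 + x ^ 2)) := by positivity
  rw [sq, ← norm_mul, h, Complex.norm_real, Real.norm_of_nonneg h2]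
  congr 2
  ring

lemma g0_sample_sq_le {α : ℝ} (hα : 0 < α) (t : ℝ) (m : ℤ) :
    (Summable fun j : ℤ ↦ ‖g0 (t + 2 * α * j - α * m)‖ ^ 2) ∧
      ∑' j : ℤ, ‖g0 (t + 2 * α * j - α * m)‖ ^ 2 ≤ latticeGaussian α t := by
  have hs := (hasSum_exp_evenKernel hα t).summable.mul_left (Real.sqrt 2)
  have hinj : Function.Injective fun j : ℤ ↦ 2 * j - m := fun i j h ↦ by simp only at h; omega
  have e (j : ℤ) : ‖g0 (t + 2 * α * j - α * m)‖ ^ 2 =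
      Real.sqrt 2 * Real.exp (-(2 * Real.pi) * (t + α * (2 * j - m : ℤ)) ^ 2) := by
    rw [norm_sq_g0]
    congr 3
    push_cast; ring
  simp_rw [e]
  refine ⟨hs.comp_injective hinj, ?_⟩
  rw [latticeGaussian, ← tsum_mul_left]
  exact (hs.comp_injective hinj).tsum_le_tsum_of_inj _ hinj (fun _ _ ↦ by positivity)
    (fun _ ↦ le_rfl) hs

lemma norm_sample_le {a : ℤ → ℂ} (ha : Summable fun j ↦ ‖a j‖ ^ 2) {α : ℝ} (hα : 0 < α)
    (t : ℝ) (m : ℤ) : (Summable fun j : ℤ ↦ ‖a j * g0 (t + 2 * α * j - α * m)‖) ∧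
    ‖∑' j : ℤ, a j * g0 (t + 2 * α * j - α * m)‖ ^ 2 ≤
      latticeGaussian α t * ∑' j, ‖a j‖ ^ 2 := by
  obtain ⟨hg, hgle⟩ := g0_sample_sq_le hα t m
  obtain ⟨h1, h2⟩ := Real.summable_and_inner_le_Lp_mul_Lq_tsum_of_nonneg
    (f := fun j ↦ ‖a j‖) (g := fun j : ℤ ↦ ‖g0 (t + 2 * α * j - α * m)‖)
    (Real.HolderConjugate.two_two) (fun _ ↦ norm_nonneg _) (fun _ ↦ norm_nonneg _)
    (by simpa using ha) (by simpa using hg)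
  simp_rw [norm_mul]
  refine ⟨h1, ?_⟩
  have h3 : ‖∑' j : ℤ, a j * g0 (t + 2 * α * j - α * m)‖ ≤
      ∑' j : ℤ, ‖a j‖ * ‖g0 (t + 2 * α * j - α * m)‖ := by
    simpa only [norm_mul] using norm_tsum_le_tsum_norm
      (f := fun j : ℤ ↦ a j * g0 (t + 2 * α * j - α * m)) (by simpa only [norm_mul] using h1)
  refine (pow_le_pow_left₀ (norm_nonneg _) (h3.trans h2) 2).trans ?_
  simp only [Real.rpow_two, ← Real.sqrt_eq_rpow]
  rw [mul_pow, Real.sq_sqrt (tsum_nonneg fun _ ↦ by positivity),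
    Real.sq_sqrt (tsum_nonneg fun _ ↦ by positivity), mul_comm]
  exact mul_le_mul_of_nonneg_right hgle (tsum_nonneg fun _ ↦ by positivity)

/-- The change of variables `m = 2 j + d - k`, `j' = j + d`, with inverse `d = j' - j`,
`k = j + j' - m`. It separates the variables in the product of two Gaussian samples. -/
def gramEquiv : (ℤ × ℤ) × ℤ ≃ ℤ × (ℤ × ℤ) where
  toFun p := (2 * p.2 + p.1.2 - p.1.1, (p.2, p.2 + p.1.2))
  invFun p := ((p.2.1 + p.2.2 - p.1, p.2.2 - p.2.1), p.2.1)
  left_inv p := by ext <;> simp; ring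
  right_inv p := by ext <;> simp; ring

lemma g0_mul_g0_shift (α t : ℝ) (k d j : ℤ) :
    g0 (t + 2 * α * j - α * (2 * j + d - k : ℤ)) *
      g0 (t + 2 * α * (j + d : ℤ) - α * (2 * j + d - k : ℤ)) =
    ((Real.sqrt 2 * Real.exp (-(2 * Real.pi) * (t + α * k) ^ 2) *
      Real.exp (-Real.pi * d ^ 2 * (2 * α ^ 2)) : ℝ) : ℂ) := by
  rw [g0_mul_g0, mul_assoc √2, ← Real.exp_add]
  congr 3
  push_cast
  ring

/-- The fibre of the frame operator at `t`, for `α β = 1/2`. In the expansion of the squares the Gaussians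
combine, by the change of variables `gramEquiv`, to `latticeGaussian α t` times a Toeplitz form. -/
lemma hasSum_norm_sq_sample {a : ℤ → ℂ} (ha : Summable fun j ↦ ‖a j‖ ^ 2) {α : ℝ} (hα : 0 < α)
    (t : ℝ) :
    HasSum (fun m : ℤ ↦ ‖∑' j : ℤ, a j * g0 (t + 2 * α * j - α * m)‖ ^ 2)
      (latticeGaussian α t * (thetaFour (2 * α ^ 2) * ∑' j, ‖a j‖ ^ 2 -
        ∑' n : ℕ, (-1) ^ (n + 1) * Real.exp (-Real.pi * (n + 1) ^ 2 * (2 * α ^ 2)) *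
          altDiff a (n + 1))) := by
  have hs : 0 < 2 * α ^ 2 := by positivity
  obtain ⟨c, hc⟩ : ∃ c : ℤ → ℝ,
    ∀ k, c k = Real.sqrt 2 * Real.exp (-(2 * Real.pi) * (t + α * k) ^ 2) := ⟨_, fun _ ↦ rfl⟩
  obtain ⟨q, hq⟩ : ∃ q : ℤ → ℝ, ∀ d : ℤ, q d = Real.exp (-Real.pi * d ^ 2 * (2 * α ^ 2)) :=
    ⟨_, fun _ ↦ rfl⟩
  have hc0 (k : ℤ) : 0 ≤ c k := by rw [hc]; positivity
  have hq0 (d : ℤ) : 0 ≤ q d := by rw [hq]; positivity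
  have hcs : HasSum c (latticeGaussian α t) := by
    have := (hasSum_exp_evenKernel hα t).summable.hasSum.mul_left (Real.sqrt 2)
    exact this.congr_fun hc
  have hqs : Summable q := by
    have := (hasSum_int_thetaThree hs).summable
    exact this.congr fun d ↦ (hq d).symm
  have hcq : Summable fun p : ℤ × ℤ ↦ c p.1 * q p.2 :=
    hcs.summable.mul_of_nonneg hqs hc0 hq0
  set T : (ℤ × ℤ) × ℤ → ℂ := fun p ↦ ((c p.1.1 * q p.1.2 : ℝ) : ℂ) *
    (a p.2 * conj (a (p.2 + p.1.2))) with hT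
  have hTs : Summable T := by
    refine Summable.of_norm ?_
    have hn (p : (ℤ × ℤ) × ℤ) : ‖T p‖ = c p.1.1 * q p.1.2 * (‖a p.2‖ * ‖a (p.2 + p.1.2)‖) := by
      simp only [hT, norm_mul, Complex.norm_real, RCLike.norm_conj]
      rw [Real.norm_of_nonneg (hc0 _), Real.norm_of_nonneg (hq0 _)]
    have hfib (p : ℤ × ℤ) : Summable fun j ↦ c p.1 * q p.2 * (‖a j‖ * ‖a (j + p.2)‖) :=
      Summable.mul_left (c p.1 * q p.2) (summable_norm_mul_shift ha p.2)
    have hsum : Summable fun p : ℤ × ℤ ↦ ∑' j, c p.1 * q p.2 * (‖a j‖ * ‖a (j + p.2)‖) := by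
      have hcq' := hcq.mul_right (∑' j, ‖a j‖ ^ 2)
      refine Summable.of_nonneg_of_le (fun p ↦ tsum_nonneg fun j ↦ ?_) (fun p ↦ ?_) hcq'
      · have := hc0 p.1; have := hq0 p.2; positivity
      · rw [tsum_mul_left]
        exact mul_le_mul_of_nonneg_left (tsum_norm_mul_shift_le ha _)
          (mul_nonneg (hc0 _) (hq0 _))
    refine Summable.congr (f := fun p : (ℤ × ℤ) × ℤ ↦
      c p.1.1 * q p.1.2 * (‖a p.2‖ * ‖a (p.2 + p.1.2)‖)) ?_ fun p ↦ (hn p).symm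
    rw [summable_prod_of_nonneg (fun p ↦ by
      have := hc0 p.1.1; have := hq0 p.1.2; simp only [Pi.zero_apply]; positivity)]
    exact ⟨hfib, hsum⟩
  -- the sum over `k`, `d`, `j` factors into the sum of `c` and the Toeplitz form
  have hval : (∑' p, T p).re = latticeGaussian α t * (thetaFour (2 * α ^ 2) * ∑' j, ‖a j‖ ^ 2 -
        ∑' n : ℕ, (-1) ^ (n + 1) * Real.exp (-Real.pi * (n + 1) ^ 2 * (2 * α ^ 2)) *
          altDiff a (n + 1)) := by
    have h1 : HasSum (fun p : ℤ × ℤ ↦ c p.1 * (q p.2 * (autocorr a p.2).re)) (∑' p, T p).re := by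
      have := Complex.hasSum_re (hTs.hasSum.prod_fiberwise fun p ↦
        ((summable_autocorr ha p.2).hasSum.mul_left ((c p.1 * q p.2 : ℝ) : ℂ)))
      refine this.congr_fun fun p ↦ ?_
      rw [Complex.re_ofReal_mul, mul_assoc]
      rfl
    have h2 := (hasSum_exp_mul_autocorr ha hs).congr_fun (g := fun d ↦ q d * (autocorr a d).re)
      fun d ↦ by rw [hq]
    have h3 := h1.prod_fiberwise fun k ↦ h2.mul_left (c k)
    exact h3.unique (hcs.mul_right _)
  rw [← hval]
  have h4 := (gramEquiv.symm.hasSum_iff.2 hTs.hasSum)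
  have hg (m : ℤ) : Summable fun j : ℤ ↦ ‖a j * g0 (t + 2 * α * j - α * m)‖ :=
    (norm_sample_le ha hα t m).1
  have h5 : HasSum (fun m : ℤ ↦ ((∑' j : ℤ, a j * g0 (t + 2 * α * j - α * m)) *
      conj (∑' j : ℤ, a j * g0 (t + 2 * α * j - α * m)))) (∑' p, T p) := by
    refine h4.prod_fiberwise fun m ↦ ?_
    have hg' : Summable fun j : ℤ ↦ ‖conj (a j * g0 (t + 2 * α * j - α * m))‖ := by
      simpa only [RCLike.norm_conj] using hg m
    rw [Complex.conj_tsum]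
    have := (summable_mul_of_summable_norm (hg m) hg').hasSum
    rw [← tsum_mul_tsum_of_summable_norm (hg m) hg'] at this
    refine this.congr_fun fun p ↦ ?_
    have key := g0_mul_g0_shift α t (p.1 + p.2 - m) (p.2 - p.1) p.1
    have e1 : 2 * p.1 + (p.2 - p.1) - (p.1 + p.2 - m) = m := by ring
    have e2 : p.1 + (p.2 - p.1) = p.2 := by ring
    rw [e1, e2] at key
    simp only [hT, Function.comp, gramEquiv, Equiv.coe_fn_symm_mk, hc, hq]
    rw [e2, ← key, map_mul, conj_g0]
    ring
  refine (Complex.hasSum_re h5).congr_fun fun m ↦ ?_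
  rw [Complex.mul_conj, Complex.ofReal_re, Complex.sq_norm]

/-! ### The frame operator on fibres -/

/-- The parametrisation of `T ℤ` by `ℤ`. -/
noncomputable def intEquivZMultiples {T : ℝ} (hT : 0 < T) : ℤ ≃ AddSubgroup.zmultiples T :=
  Equiv.ofBijective (fun n ↦ ⟨n • T, n, rfl⟩) <| by
    constructor
    · intro m n h
      simpa [hT.ne'] using congrArg Subtype.val h
    · rintro ⟨_, n, rfl⟩
      exact ⟨n, rfl⟩

lemma lintegral_eq_setLIntegral_tsum {T : ℝ} (hT : 0 < T) {f : ℝ → ℝ≥0∞}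
    (hf : AEMeasurable f) :
    ∫⁻ t, f t = ∫⁻ t in Ioc 0 T, ∑' j : ℤ, f (t + T * j) := by
  have h := (isAddFundamentalDomain_Ioc hT 0).lintegral_eq_tsum'' f
  rw [h, ← (intEquivZMultiples hT).tsum_eq, zero_add, lintegral_tsum]
  · refine tsum_congr fun j ↦ lintegral_congr fun t ↦ ?_
    congr 1
    simp [intEquivZMultiples, AddSubgroup.vadd_def, add_comm, mul_comm]
  · intro j
    exact (hf.comp_quasiMeasurePreserving
      (measurePreserving_add_right volume (T * j)).quasiMeasurePreserving).restrict

lemma integral_eq_setIntegral_tsum {T : ℝ} (hT : 0 < T) {f : ℝ → ℂ} (hf : Integrable f) :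
    ∫ t, f t = ∫ t in Ioc 0 T, ∑' j : ℤ, f (t + T * j) := by
  have h := (isAddFundamentalDomain_Ioc hT 0).integral_eq_tsum'' f hf
  have hm (j : ℤ) : AEStronglyMeasurable (fun t ↦ f (t + T * j)) (volume.restrict (Ioc 0 T)) :=
    (hf.1.comp_quasiMeasurePreserving
      (measurePreserving_add_right volume (T * j)).quasiMeasurePreserving).restrict
  rw [h, ← (intEquivZMultiples hT).tsum_eq, zero_add, integral_tsum hm]
  · refine tsum_congr fun j ↦ integral_congr_ae (.of_forall fun t ↦ ?_)
    simp [intEquivZMultiples, AddSubgroup.vadd_def, add_comm, mul_comm]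
  · rw [← lintegral_tsum fun j ↦ (hm j).enorm,
      ← lintegral_eq_setLIntegral_tsum hT hf.1.enorm]
    exact hf.2.ne

/-- Parseval's identity on `(0, T]`, in `[0, ∞]`. -/
lemma tsum_enorm_sq_fourier {T : ℝ} (hT : 0 < T) {F : ℝ → ℂ}
    (hF : MemLp F 2 (volume.restrict (Ioc 0 T))) :
    ∑' n : ℤ, ‖∫ t in Ioc 0 T, F t * Complex.exp (-2 * Real.pi * Complex.I * (n / T : ℝ) * t)‖ₑ ^ 2
      = ENNReal.ofReal T * ∫⁻ t in Ioc 0 T, ‖F t‖ₑ ^ 2 := by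
  have h := hasSum_sq_fourierCoeffOn hT hF
  have hc (n : ℤ) : ∫ t in Ioc 0 T, F t * Complex.exp (-2 * Real.pi * Complex.I * (n / T : ℝ) * t)
      = T * fourierCoeffOn hT F n := by
    rw [fourierCoeffOn_eq_integral, intervalIntegral.integral_of_le hT.le, Complex.real_smul,
      ← mul_assoc, ← Complex.ofReal_mul, sub_zero, mul_one_div_cancel hT.ne', Complex.ofReal_one,
      one_mul]
    refine integral_congr_ae (.of_forall fun t ↦ ?_)
    simp only [smul_eq_mul]
    rw [fourier_coe_apply, mul_comm]
    congr 2
    push_cast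
    ring
  have hsq : ENNReal.ofReal (∫ x in (0 : ℝ)..T, ‖F x‖ ^ 2) = ∫⁻ t in Ioc 0 T, ‖F t‖ₑ ^ 2 := by
    rw [intervalIntegral.integral_of_le hT.le, ofReal_integral_eq_lintegral_ofReal
      ((memLp_two_iff_integrable_sq_norm hF.1).1 hF) (.of_forall fun t ↦ by positivity)]
    refine lintegral_congr fun t ↦ ?_
    rw [ENNReal.ofReal_pow (norm_nonneg _), ofReal_norm]
  have h2 := h.mul_left (T ^ 2)
  have e : T ^ 2 * ((T - 0)⁻¹ • ∫ x in (0 : ℝ)..T, ‖F x‖ ^ 2) = T * ∫ x in (0 : ℝ)..T, ‖F x‖ ^ 2 := by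
    rw [smul_eq_mul, sub_zero]; field_simp
  rw [e] at h2
  rw [← hsq, ← ENNReal.ofReal_mul hT.le, ← h2.tsum_eq,
    ENNReal.ofReal_tsum_of_nonneg (fun _ ↦ by positivity) h2.summable]
  refine tsum_congr fun n ↦ ?_
  rw [hc, enorm_mul, mul_pow, ENNReal.ofReal_mul (by positivity), ENNReal.ofReal_pow hT.le,
    ENNReal.ofReal_pow (norm_nonneg _), ofReal_norm]
  congr 2
  rw [← ofReal_norm, Complex.norm_real, Real.norm_of_nonneg hT.le]

lemma continuous_g0 : Continuous g0 := by unfold g0; fun_prop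

lemma memLp_g0_shift (x : ℝ) : MemLp (fun t ↦ g0 (t - x)) 2 := by
  have hc : Continuous fun t ↦ g0 (t - x) := continuous_g0.comp (by fun_prop)
  rw [memLp_two_iff_integrable_sq_norm hc.aestronglyMeasurable]
  simp_rw [norm_sq_g0]
  have : Integrable fun t : ℝ ↦ Real.exp (-(2 * Real.pi) * t ^ 2) :=
    integrable_exp_neg_mul_sq (by positivity)
  exact (this.comp_sub_right x).const_mul _

lemma latticeGaussian_eq_evenKernel {α : ℝ} (hα : 0 < α) (t : ℝ) : latticeGaussian α t =
    Real.sqrt 2 * HurwitzZeta.evenKernel ((t / α : ℝ) : UnitAddCircle) (2 * α ^ 2) := by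
  rw [latticeGaussian, (hasSum_exp_evenKernel hα t).tsum_eq]

lemma continuous_latticeGaussian {α : ℝ} (hα : 0 < α) : Continuous (latticeGaussian α) := by
  have h2 : latticeGaussian α = fun t ↦ Real.sqrt 2 *
      (Complex.exp (-Real.pi * (t / α : ℝ) ^ 2 * (2 * α ^ 2 : ℝ)) *
        jacobiTheta₂ ((t / α : ℝ) * Complex.I * (2 * α ^ 2 : ℝ))
          (Complex.I * (2 * α ^ 2 : ℝ))).re := by
    funext t
    rw [latticeGaussian_eq_evenKernel hα, ← HurwitzZeta.evenKernel_def, Complex.ofReal_re]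
  rw [h2]
  have hj : Continuous fun z : ℂ ↦ jacobiTheta₂ z (Complex.I * (2 * α ^ 2 : ℝ)) := by
    refine Differentiable.continuous (𝕜 := ℂ) fun z ↦ differentiableAt_jacobiTheta₂_fst z ?_
    have : 0 < 2 * α ^ 2 := by positivity
    simpa only [Complex.I_mul_im, Complex.ofReal_re] using this
  refine continuous_const.mul (Complex.continuous_re.comp (Continuous.mul (by fun_prop)
    (hj.comp (by fun_prop))))

section
variable {f : ℝ → ℂ}

lemma ae_summable_norm_sq {T : ℝ} (hT : 0 < T) (hf : MemLp f 2) :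
    ∀ᵐ t ∂volume.restrict (Ioc 0 T), Summable fun j : ℤ ↦ ‖f (t + T * j)‖ ^ 2 := by
  have hm : AEMeasurable fun t ↦ ‖f t‖ₑ ^ 2 := hf.1.enorm.pow_const 2
  have h : ∫⁻ t in Ioc 0 T, ∑' j : ℤ, ‖f (t + T * j)‖ₑ ^ 2 ≠ ∞ := by
    rw [← lintegral_eq_setLIntegral_tsum hT hm]
    have := hf.2
    rw [eLpNorm_lt_top_iff_lintegral_rpow_enorm_lt_top two_ne_zero ENNReal.ofNat_ne_top] at this
    simpa using this.ne
  have hm' : AEMeasurable (fun t ↦ ∑' j : ℤ, ‖f (t + T * j)‖ₑ ^ 2) (volume.restrict (Ioc 0 T)) :=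
    AEMeasurable.tsum fun j ↦ (hm.comp_quasiMeasurePreserving
      (measurePreserving_add_right volume (T * j)).quasiMeasurePreserving).restrict
  filter_upwards [ae_lt_top' hm' h] with t ht
  have := ENNReal.summable_toReal ht.ne
  simpa using this

lemma eLpNorm_two_sq (hf : MemLp f 2) {T : ℝ} (hT : 0 < T) :
    eLpNorm f 2 volume ^ 2 =
      ∫⁻ t in Ioc 0 T, ENNReal.ofReal (∑' j : ℤ, ‖f (t + T * j)‖ ^ 2) := by
  have hm : AEMeasurable fun t ↦ ‖f t‖ₑ ^ 2 := hf.1.enorm.pow_const 2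
  have h1 : eLpNorm f 2 volume ^ 2 = ∫⁻ t, ‖f t‖ₑ ^ 2 := by
    simpa using eLpNorm_nnreal_pow_eq_lintegral (f := f) (μ := volume) (p := 2) two_ne_zero
  rw [h1, lintegral_eq_setLIntegral_tsum hT hm]
  refine lintegral_congr_ae ?_
  filter_upwards [ae_summable_norm_sq hT hf] with t ht
  rw [ENNReal.ofReal_tsum_of_nonneg (fun _ ↦ by positivity) ht]
  refine tsum_congr fun j ↦ ?_
  rw [ENNReal.ofReal_pow (norm_nonneg _), ofReal_norm]

lemma memLp_periodization {α : ℝ} (hα : 0 < α) (hf : MemLp f 2) (m : ℤ) :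
    MemLp (fun t ↦ ∑' j : ℤ, f (t + 2 * α * j) * g0 (t + 2 * α * j - α * m)) 2
      (volume.restrict (Ioc 0 (2 * α))) := by
  have hT : 0 < 2 * α := by positivity
  have hae := ae_summable_norm_sq hT hf
  have hmeas : AEStronglyMeasurable
      (fun t ↦ ∑' j : ℤ, f (t + 2 * α * j) * g0 (t + 2 * α * j - α * m))
      (volume.restrict (Ioc 0 (2 * α))) := by
    refine aestronglyMeasurable_of_tendsto_ae (u := Filter.atTop) (f := fun (s : Finset ℤ) t ↦
      ∑ j ∈ s, f (t + 2 * α * j) * g0 (t + 2 * α * j - α * m)) (fun s ↦ ?_) ?_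
    · refine Finset.aestronglyMeasurable_fun_sum s fun j _ ↦ ?_
      refine (AEStronglyMeasurable.mul (hf.1.comp_quasiMeasurePreserving
        (measurePreserving_add_right volume (2 * α * j)).quasiMeasurePreserving) ?_).restrict
      exact (continuous_g0.comp (by fun_prop)).aestronglyMeasurable
    · filter_upwards [hae] with t ht
      exact (norm_sample_le ht hα t m).1.of_norm.hasSum
  obtain ⟨K, hK⟩ := (isCompact_Icc (a := (0 : ℝ)) (b := 2 * α)).exists_bound_of_continuousOn
    (continuous_latticeGaussian hα).continuousOn
  refine ⟨hmeas, ?_⟩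
  rw [eLpNorm_lt_top_iff_lintegral_rpow_enorm_lt_top two_ne_zero ENNReal.ofNat_ne_top]
  have hle : ∫⁻ t in Ioc 0 (2 * α),
      ‖∑' j : ℤ, f (t + 2 * α * j) * g0 (t + 2 * α * j - α * m)‖ₑ ^ (2 : ℝ≥0∞).toReal ≤
      ∫⁻ t in Ioc 0 (2 * α), ENNReal.ofReal K *
        ENNReal.ofReal (∑' j : ℤ, ‖f (t + 2 * α * j)‖ ^ 2) := by
    refine lintegral_mono_ae ?_
    filter_upwards [hae, ae_restrict_mem measurableSet_Ioc] with t ht htm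
    have h1 := (norm_sample_le ht hα t m).2
    have h2 := (le_abs_self _).trans (hK t ⟨htm.1.le, htm.2⟩)
    have h0 : 0 ≤ ∑' j : ℤ, ‖f (t + 2 * α * j)‖ ^ 2 := tsum_nonneg fun _ ↦ by positivity
    rw [← ENNReal.ofReal_mul' h0]
    simp only [ENNReal.toReal_ofNat, ENNReal.rpow_ofNat]
    rw [← ofReal_norm, ← ENNReal.ofReal_pow (norm_nonneg _)]
    exact ENNReal.ofReal_le_ofReal (h1.trans (mul_le_mul_of_nonneg_right h2 h0))
  refine hle.trans_lt ?_
  rw [lintegral_const_mul' _ _ ENNReal.ofReal_ne_top, ← eLpNorm_two_sq hf hT]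
  exact ENNReal.mul_lt_top ENNReal.ofReal_lt_top (ENNReal.pow_lt_top hf.2)

/-- For fixed `m` the inner products with `π(α m, β n) g₀` are the Fourier coefficients of the
`2 α`-periodisation of `f · g₀(· - α m)`. -/
lemma tsum_sepLattice_inner_eq {α β : ℝ} (hα : 0 < α) (hβ : β = 1 / (2 * α)) (hf : MemLp f 2) :
    ∑' z : sepLattice α β, ‖innerL2 f (timeFreqShift (z : ℝ × ℝ) g0)‖ₑ ^ 2 =
      ENNReal.ofReal (2 * α) * ∫⁻ t in Ioc 0 (2 * α),
        ∑' m : ℤ, ‖∑' j : ℤ, f (t + 2 * α * j) * g0 (t + 2 * α * j - α * m)‖ₑ ^ 2 := by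
  have hT : 0 < 2 * α := by positivity
  have hβ0 : β ≠ 0 := by rw [hβ]; positivity
  rw [tsum_sepLattice hα.ne' hβ0 (fun z ↦ ‖innerL2 f (timeFreqShift z g0)‖ₑ ^ 2),
    lintegral_tsum fun m ↦ (memLp_periodization hα hf m).1.enorm.pow_const 2,
    ← ENNReal.tsum_mul_left]
  refine tsum_congr fun m ↦ ?_
  rw [← tsum_enorm_sq_fourier hT (memLp_periodization hα hf m)]
  refine tsum_congr fun n ↦ ?_
  congr 2
  set e : ℝ → ℂ := fun t ↦ Complex.exp (-2 * Real.pi * Complex.I * (n / (2 * α) : ℝ) * t) with he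
  have hint : Integrable fun t ↦ f t * g0 (t - α * m) * e t := by
    refine (hf.integrable_mul (memLp_g0_shift (α * m))).mul_bdd (c := 1) ?_ (.of_forall fun t ↦ ?_)
    · exact (by fun_prop : Continuous e).aestronglyMeasurable
    · rw [he]
      have : -2 * Real.pi * Complex.I * (n / (2 * α) : ℝ) * t =
        ((-2 * Real.pi * (n / (2 * α)) * t : ℝ) : ℂ) * Complex.I := by push_cast; ring
      simp only [this, Complex.norm_exp_ofReal_mul_I, le_refl]
  have h1 : innerL2 f (timeFreqShift ((m * α, n * β) : ℝ × ℝ) g0) =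
      ∫ t, f t * g0 (t - α * m) * e t := by
    refine integral_congr_ae (.of_forall fun t ↦ ?_)
    have hE : conj (Complex.exp (2 * Real.pi * Complex.I * (n * β : ℝ) * t)) = e t := by
      rw [he, ← Complex.exp_conj]
      simp only [map_mul, Complex.conj_I, Complex.conj_ofReal, map_ofNat, hβ]
      congr 1
      push_cast
      ring
    simp only [timeFreqShift, map_mul, conj_g0]
    rw [hE, mul_comm (m : ℝ)]
    ring
  rw [h1, integral_eq_setIntegral_tsum hT hint]
  refine integral_congr_ae (.of_forall fun t ↦ ?_)
  simp only
  rw [← tsum_mul_right]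
  refine tsum_congr fun j ↦ ?_
  congr 1
  -- `e` has period `2 α`
  simp only [he]
  rw [Complex.exp_eq_exp_iff_exists_int]
  refine ⟨-(n * j), ?_⟩
  have hα' : (α : ℂ) ≠ 0 := Complex.ofReal_ne_zero.2 hα.ne'
  push_cast
  field_simp
  ring

lemma tsum_sepLattice_inner_eq_lintegral {α β : ℝ} (hα : 0 < α) (hβ : β = 1 / (2 * α))
    (hf : MemLp f 2) :
    ∑' z : sepLattice α β, ‖innerL2 f (timeFreqShift (z : ℝ × ℝ) g0)‖ₑ ^ 2 =
      ENNReal.ofReal (2 * α) * ∫⁻ t in Ioc 0 (2 * α), ENNReal.ofReal (latticeGaussian α t *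
        (thetaFour (2 * α ^ 2) * ∑' j : ℤ, ‖f (t + 2 * α * j)‖ ^ 2 -
          ∑' n : ℕ, (-1) ^ (n + 1) * Real.exp (-Real.pi * (n + 1) ^ 2 * (2 * α ^ 2)) *
            altDiff (fun j ↦ f (t + 2 * α * j)) (n + 1))) := by
  rw [tsum_sepLattice_inner_eq hα hβ hf]
  congr 1
  refine lintegral_congr_ae ?_
  filter_upwards [ae_summable_norm_sq (by positivity : 0 < 2 * α) hf] with t ht
  have h := hasSum_norm_sq_sample ht hα t
  rw [← h.tsum_eq, ENNReal.ofReal_tsum_of_nonneg (fun _ ↦ by positivity) h.summable]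
  refine tsum_congr fun m ↦ ?_
  rw [ENNReal.ofReal_pow (norm_nonneg _), ofReal_norm]

end

/-! ### Frame bounds -/

lemma thetaFour_nonneg {s : ℝ} (hs : 0 < s) : 0 ≤ thetaFour s :=
  ge_of_tendsto' (tendsto_gaussProd hs) fun n ↦
    (gaussProd_pos (Real.exp_pos _)
      (Real.exp_lt_one_iff.2 (by nlinarith [Real.pi_pos])) n).le

lemma latticeGaussian_nonneg (α t : ℝ) : 0 ≤ latticeGaussian α t :=
  mul_nonneg (Real.sqrt_nonneg 2) (tsum_nonneg fun _ ↦ (Real.exp_pos _).le)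

lemma isLowerFrameBound_square : IsLowerFrameBound g0
    (sepLattice (1 / Real.sqrt 2) (1 / Real.sqrt 2)) (ENNReal.ofReal (2 * thetaFour 1 ^ 2)) := by
  intro f hf
  have h2 : Real.sqrt 2 ^ 2 = 2 := Real.sq_sqrt (by norm_num)
  have hs : 0 < Real.sqrt 2 := by positivity
  have hα : 0 < 1 / Real.sqrt 2 := by positivity
  have hs1 : 2 * (1 / Real.sqrt 2) ^ 2 = 1 := by rw [div_pow, h2]; norm_num
  have hθ := thetaFour_one_pos
  rw [tsum_sepLattice_inner_eq_lintegral hα (by field_simp; linarith) hf,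
    eLpNorm_two_sq hf (by positivity : 0 < 2 * (1 / Real.sqrt 2)), hs1]
  have hle : ∫⁻ t in Ioc 0 (2 * (1 / Real.sqrt 2)), ENNReal.ofReal (Real.sqrt 2 * thetaFour 1 ^ 2) *
      ENNReal.ofReal (∑' j : ℤ, ‖f (t + 2 * (1 / Real.sqrt 2) * j)‖ ^ 2) ≤
      ∫⁻ t in Ioc 0 (2 * (1 / Real.sqrt 2)), ENNReal.ofReal (latticeGaussian (1 / Real.sqrt 2) t *
        (thetaFour 1 * ∑' j : ℤ, ‖f (t + 2 * (1 / Real.sqrt 2) * j)‖ ^ 2 -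
          ∑' n : ℕ, (-1) ^ (n + 1) * Real.exp (-Real.pi * (n + 1) ^ 2 * 1) *
            altDiff (fun j ↦ f (t + 2 * (1 / Real.sqrt 2) * j)) (n + 1))) := by
    refine lintegral_mono_ae ?_
    filter_upwards [ae_summable_norm_sq (by positivity : 0 < 2 * (1 / Real.sqrt 2)) hf] with t ht
    have hE := (tsum_alternating_nonpos (Real.exp_pos (-Real.pi)) exp_neg_pi_lt
      (altDiff_nonneg (fun j : ℤ ↦ f (t + 2 * (1 / Real.sqrt 2) * j))) (altDiff_le ht)).2
    have hE' : ∑' n : ℕ, (-1) ^ (n + 1) * Real.exp (-Real.pi * (n + 1) ^ 2 * 1) *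
            altDiff (fun j : ℤ ↦ f (t + 2 * (1 / Real.sqrt 2) * j)) (n + 1) ≤ 0 := by
      refine le_of_eq_of_le (tsum_congr fun n ↦ ?_) hE
      rw [← Real.exp_nat_mul]
      push_cast
      ring_nf
    have hC : Real.sqrt 2 * thetaFour 1 ≤ latticeGaussian (1 / Real.sqrt 2) t := by
      rw [latticeGaussian_eq_evenKernel hα, hs1, HurwitzZeta.evenKernel_functional_equation]
      simpa using thetaFour_one_le_cosKernel (t / (1 / Real.sqrt 2))
    have h0 : 0 ≤ ∑' j : ℤ, ‖f (t + 2 * (1 / Real.sqrt 2) * j)‖ ^ 2 :=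
      tsum_nonneg fun _ ↦ by positivity
    rw [← ENNReal.ofReal_mul (by positivity)]
    refine ENNReal.ofReal_le_ofReal ?_
    calc _ = (Real.sqrt 2 * thetaFour 1) *
          (thetaFour 1 * ∑' j : ℤ, ‖f (t + 2 * (1 / Real.sqrt 2) * j)‖ ^ 2) := by ring
      _ ≤ _ := mul_le_mul hC (by linarith) (by positivity) (latticeGaussian_nonneg _ _)
  refine le_trans (le_of_eq ?_) (mul_le_mul_right hle _)
  rw [lintegral_const_mul' _ _ ENNReal.ofReal_ne_top, ← mul_assoc,
    ← ENNReal.ofReal_mul (by positivity)]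
  congr 2
  field_simp

/-- The sequence `(-1)^j` for `0 ≤ j < N`, and `0` elsewhere. -/
noncomputable def altBlock (N : ℕ) (j : ℤ) : ℂ := if j ∈ Finset.Ico (0 : ℤ) N then (-1) ^ j else 0

lemma norm_sq_altBlock (N : ℕ) (j : ℤ) :
    ‖altBlock N j‖ ^ 2 = if j ∈ Finset.Ico (0 : ℤ) N then 1 else 0 := by
  unfold altBlock
  split_ifs <;> simp

lemma hasSum_altBlock (N : ℕ) : HasSum (fun j ↦ ‖altBlock N j‖ ^ 2) N := by
  have h : HasSum (fun j ↦ ‖altBlock N j‖ ^ 2) (∑ j ∈ Finset.Ico (0 : ℤ) N, ‖altBlock N j‖ ^ 2) :=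
    hasSum_sum_of_ne_finset_zero fun j hj ↦ by rw [norm_sq_altBlock, if_neg hj]
  convert h using 1
  rw [Finset.sum_congr rfl fun j hj ↦ by rw [norm_sq_altBlock, if_pos hj]]
  simp

lemma altDiff_altBlock_le (N : ℕ) : altDiff (altBlock N) 1 ≤ 2 := by
  -- only the two ends of the block contribute
  have h : HasSum (fun j : ℤ ↦ (if j = -1 then (1 : ℝ) else 0) + if j = N - 1 then 1 else 0) (1 + 1) :=
    (hasSum_ite_eq (-1) 1).add (hasSum_ite_eq _ 1)
  refine (hasSum_le (fun j ↦ ?_) (summable_altDiff (hasSum_altBlock N).summable 1).hasSum h).trans_eq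
    (by norm_num)
  have hz : ((-1 : ℂ)) ^ (j + 1) = -(-1) ^ j := by
    rw [zpow_add₀ (by norm_num)]; simp
  simp only [altBlock, Finset.mem_Ico, Nat.cast_one, pow_one]
  split_ifs <;> first | omega | simp [hz]

/-- The function `∑_{0 ≤ i < N} (-1)^i 1_{(α/2, α/2 + δ]}(· - 2 α i)`. It is concentrated, in the
time-frequency plane, where the frame operator is smallest. -/
noncomputable def combFunction (α δ : ℝ) (N : ℕ) (x : ℝ) : ℂ :=
  ∑ i ∈ Finset.range N,
    (Ioc (α / 2 + 2 * α * i) (α / 2 + 2 * α * i + δ)).indicator (fun _ ↦ (-1 : ℂ) ^ i) x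

lemma memLp_combFunction (α δ : ℝ) (N : ℕ) : MemLp (combFunction α δ N) 2 :=
  memLp_finsetSum _ fun _ _ ↦ memLp_indicator_const 2 measurableSet_Ioc _ (.inr (by simp))

lemma combFunction_sample {α δ : ℝ} (hδα : δ ≤ α) (N : ℕ) {t : ℝ}
    (ht : t ∈ Ioc 0 (2 * α)) (j : ℤ) : combFunction α δ N (t + 2 * α * j) =
      if t ∈ Ioc (α / 2) (α / 2 + δ) then altBlock N j else 0 := by
  have hα : 0 < α := by linarith [ht.1, ht.2]
  have hmem (i : ℕ) : t + 2 * α * j ∈ Ioc (α / 2 + 2 * α * i) (α / 2 + 2 * α * i + δ) ↔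
      t ∈ Ioc (α / 2) (α / 2 + δ) ∧ j = i := by
    constructor
    · rintro ⟨h1, h2⟩
      have h3 : (j : ℝ) < i + 1 := by
        by_contra! h; nlinarith [ht.1]
      have h4 : (i : ℝ) < j + 1 := by
        by_contra! h; nlinarith [ht.2]
      have : j = i := by
        have h3' : j < i + 1 := by exact_mod_cast h3
        have h4' : (i : ℤ) < j + 1 := by exact_mod_cast h4
        omega
      subst this
      push_cast at h1 h2
      exact ⟨⟨by linarith, by linarith⟩, rfl⟩
    · rintro ⟨⟨h1, h2⟩, rfl⟩
      push_cast
      exact ⟨by linarith, by linarith⟩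
  unfold combFunction
  simp only [indicator_apply, hmem]
  by_cases hI : t ∈ Ioc (α / 2) (α / 2 + δ)
  · simp only [hI, true_and, if_true]
    unfold altBlock
    split_ifs with h
    · rw [Finset.mem_Ico] at h
      obtain ⟨n, rfl⟩ := Int.eq_ofNat_of_zero_le h.1
      have hn : n < N := by exact_mod_cast h.2
      simp [hn]
    · refine Finset.sum_eq_zero fun i hi ↦ if_neg ?_
      rintro rfl
      exact h (by simpa using hi)
  · simp [hI]

/-- The lower frame inequality for `combFunction α δ N`, divided by `δ`. -/
lemma lowerFrameBound_mul_le {α β : ℝ} (hα : 0 < α) (hβ : β = 1 / (2 * α)) {A : ℝ≥0∞}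
    (hA : IsLowerFrameBound g0 (sepLattice α β) A) {δ M : ℝ} (hδ : 0 < δ) (hδα : δ ≤ α)
    (hM : ∀ t ∈ Ioc (α / 2) (α / 2 + δ), latticeGaussian α t ≤ M) (N : ℕ) :
    A * N ≤ ENNReal.ofReal (2 * α * (M * (thetaFour (2 * α ^ 2) * N +
      2 * ∑' n : ℕ, ((n : ℝ) + 1) ^ 2 * Real.exp (-Real.pi * (n + 1) ^ 2 * (2 * α ^ 2))))) := by
  have hs : 0 < 2 * α ^ 2 := by positivity
  have hT : 0 < 2 * α := by positivity
  set K := ∑' n : ℕ, ((n : ℝ) + 1) ^ 2 * Real.exp (-Real.pi * (n + 1) ^ 2 * (2 * α ^ 2)) with hK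
  have hK0 : 0 ≤ K := tsum_nonneg fun _ ↦ by positivity
  have hθ := thetaFour_nonneg hs
  set I := Ioc (α / 2) (α / 2 + δ) with hI
  have hIT : I ⊆ Ioc 0 (2 * α) := Ioc_subset_Ioc (by positivity) (by linarith)
  have h := hA _ (memLp_combFunction α δ N)
  rw [tsum_sepLattice_inner_eq_lintegral hα hβ (memLp_combFunction α δ N),
    eLpNorm_two_sq (memLp_combFunction α δ N) hT] at h
  have hleft : ∫⁻ t in Ioc 0 (2 * α),
      ENNReal.ofReal (∑' j : ℤ, ‖combFunction α δ N (t + 2 * α * j)‖ ^ 2) =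
      N * ENNReal.ofReal δ := by
    have : ∀ t ∈ Ioc 0 (2 * α),
        ENNReal.ofReal (∑' j : ℤ, ‖combFunction α δ N (t + 2 * α * j)‖ ^ 2) =
        I.indicator (fun _ ↦ (N : ℝ≥0∞)) t := by
      intro t ht
      simp_rw [combFunction_sample hδα N ht]
      by_cases htI : t ∈ I
      · simp only [← hI, htI, if_true, indicator_of_mem]
        rw [(hasSum_altBlock N).tsum_eq, ENNReal.ofReal_natCast]
      · simp [← hI, htI]
    rw [setLIntegral_congr_fun measurableSet_Ioc this, lintegral_indicator_const measurableSet_Ioc,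
      Measure.restrict_apply measurableSet_Ioc, inter_eq_left.2 hIT, Real.volume_Ioc]
    congr 2; ring
  have hright : ∫⁻ t in Ioc 0 (2 * α), ENNReal.ofReal (latticeGaussian α t *
        (thetaFour (2 * α ^ 2) * ∑' j : ℤ, ‖combFunction α δ N (t + 2 * α * j)‖ ^ 2 -
          ∑' n : ℕ, (-1) ^ (n + 1) * Real.exp (-Real.pi * (n + 1) ^ 2 * (2 * α ^ 2)) *
            altDiff (fun j ↦ combFunction α δ N (t + 2 * α * j)) (n + 1))) ≤
      ENNReal.ofReal (M * (thetaFour (2 * α ^ 2) * N + 2 * K)) * ENNReal.ofReal δ := by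
    have : ∀ t ∈ Ioc 0 (2 * α), ENNReal.ofReal (latticeGaussian α t *
        (thetaFour (2 * α ^ 2) * ∑' j : ℤ, ‖combFunction α δ N (t + 2 * α * j)‖ ^ 2 -
          ∑' n : ℕ, (-1) ^ (n + 1) * Real.exp (-Real.pi * (n + 1) ^ 2 * (2 * α ^ 2)) *
            altDiff (fun j ↦ combFunction α δ N (t + 2 * α * j)) (n + 1))) ≤
        I.indicator (fun _ ↦ ENNReal.ofReal (M * (thetaFour (2 * α ^ 2) * N + 2 * K))) t := by
      intro t ht
      simp_rw [combFunction_sample hδα N ht]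
      by_cases htI : t ∈ I
      · simp only [← hI, htI, if_true, indicator_of_mem]
        rw [(hasSum_altBlock N).tsum_eq]
        have hd0 := altDiff_nonneg (altBlock N)
        have hd := altDiff_le (hasSum_altBlock N).summable
        have hd1 := altDiff_altBlock_le N
        have hE : -∑' n : ℕ, (-1) ^ (n + 1) * Real.exp (-Real.pi * (n + 1) ^ 2 * (2 * α ^ 2)) *
            altDiff (altBlock N) (n + 1) ≤ 2 * K := by
          refine (neg_le_abs _).trans ?_
          rw [← Real.norm_eq_abs]
          have hsm := (summable_sq_mul_exp hs).mul_left 2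
          rw [hK, ← tsum_mul_left]
          refine tsum_of_norm_bounded hsm.hasSum fun n ↦ ?_
          rw [norm_mul, norm_mul, norm_pow, norm_neg, norm_one, one_pow, one_mul,
            Real.norm_of_nonneg (Real.exp_pos _).le, Real.norm_of_nonneg (hd0 _)]
          have h1 : altDiff (altBlock N) (n + 1) ≤ ((n : ℝ) + 1) ^ 2 * 2 := by
            refine (hd (n + 1)).trans ?_
            push_cast
            gcongr
          calc _ ≤ Real.exp (-Real.pi * (n + 1) ^ 2 * (2 * α ^ 2)) * (((n : ℝ) + 1) ^ 2 * 2) := by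
                gcongr
            _ = _ := by ring
        refine ENNReal.ofReal_le_ofReal ?_
        have h5 : 0 ≤ thetaFour (2 * α ^ 2) * N + 2 * K := by positivity
        refine (mul_le_mul_of_nonneg_left ?_ (latticeGaussian_nonneg α t)).trans
          (mul_le_mul_of_nonneg_right (hM t htI) h5)
        linarith
      · simp [← hI, htI, altDiff]
    refine (setLIntegral_mono' measurableSet_Ioc this).trans_eq ?_
    rw [lintegral_indicator_const measurableSet_Ioc,
      Measure.restrict_apply measurableSet_Ioc, inter_eq_left.2 hIT, Real.volume_Ioc]
    congr 2; ring
  rw [hleft] at h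
  have h6 := h.trans (mul_le_mul_right hright _)
  rw [← mul_assoc, ← mul_assoc, ← ENNReal.ofReal_mul hT.le] at h6
  exact (ENNReal.mul_le_mul_iff_left (ENNReal.ofReal_pos.2 hδ).ne' ENNReal.ofReal_ne_top).1 h6

/-- For `α β = 1/2` a lower frame bound is at most `2 θ₄(s) θ₄(1/s)` with `s = 2 α²`. -/
lemma lowerFrameBound_le {α β : ℝ} (hα : 0 < α) (hβ : β = 1 / (2 * α)) {A : ℝ≥0∞}
    (hA : IsLowerFrameBound g0 (sepLattice α β) A) :
    A ≤ ENNReal.ofReal (2 * (thetaFour (2 * α ^ 2) * thetaFour (1 / (2 * α ^ 2)))) := by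
  have hs : 0 < 2 * α ^ 2 := by positivity
  set θ := thetaFour (2 * α ^ 2) with hθ
  -- the bound for every `M` above the value of the lattice Gaussian at `α / 2`
  have hMbd : ∀ M, latticeGaussian α (α / 2) < M → A ≤ ENNReal.ofReal (2 * α * (M * θ)) := by
    intro M hM
    have hev := ((continuous_latticeGaussian hα).tendsto (α / 2)).eventually_lt_const hM
    obtain ⟨ε, hε, hball⟩ := Metric.eventually_nhds_iff.1 hev
    have hδ : 0 < min (ε / 2) α := lt_min (by positivity) hα
    have key := lowerFrameBound_mul_le hα hβ hA hδ (min_le_right _ _) (M := M) (fun t ht ↦ by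
      refine (hball ?_).le
      have h1 := ht.2
      have h2 := ht.1
      have h3 := min_le_left (ε / 2) α
      rw [Real.dist_eq, abs_lt]
      constructor <;> linarith)
    set K := ∑' n : ℕ, ((n : ℝ) + 1) ^ 2 * Real.exp (-Real.pi * (n + 1) ^ 2 * (2 * α ^ 2))
    have hN (N : ℕ) : A ≤ ENNReal.ofReal
        (2 * α * (M * θ) + 2 * α * M * (2 * K) * (1 / ((N : ℝ) + 1))) := by
      have h1 := key (N + 1)
      rw [← ENNReal.le_div_iff_mul_le (by simp) (by simp)] at h1
      refine h1.trans_eq ?_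
      rw [← ENNReal.ofReal_natCast (N + 1), ← ENNReal.ofReal_div_of_pos (by positivity)]
      congr 1
      push_cast
      rw [← hθ]
      field_simp
    have ht : Filter.Tendsto (fun N : ℕ ↦ ENNReal.ofReal
        (2 * α * (M * θ) + 2 * α * M * (2 * K) * (1 / ((N : ℝ) + 1)))) Filter.atTop
        (nhds (ENNReal.ofReal (2 * α * (M * θ)))) := by
      refine ENNReal.tendsto_ofReal ?_
      simpa using (tendsto_one_div_add_atTop_nhds_zero_nat (𝕜 := ℝ)).const_mul
        (2 * α * M * (2 * K)) |>.const_add (2 * α * (M * θ))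
    exact ge_of_tendsto' ht hN
  have hval : 2 * α * (latticeGaussian α (α / 2) * θ) =
      2 * (θ * thetaFour (1 / (2 * α ^ 2))) := by
    rw [latticeGaussian_eq_evenKernel hα, HurwitzZeta.evenKernel_functional_equation,
      ← Real.sqrt_eq_rpow, Real.sqrt_mul (by norm_num), Real.sqrt_sq hα.le,
      show α / 2 / α = 1 / 2 by field_simp]
    unfold thetaFour
    field_simp
  rw [← hval]
  have ht : Filter.Tendsto (fun M ↦ ENNReal.ofReal (2 * α * (M * θ)))
      (nhdsWithin (latticeGaussian α (α / 2)) (Ioi (latticeGaussian α (α / 2))))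
      (nhds (ENNReal.ofReal (2 * α * (latticeGaussian α (α / 2) * θ)))) := by
    refine (ENNReal.tendsto_ofReal ?_).mono_left nhdsWithin_le_nhds
    exact (by fun_prop : Continuous fun M ↦ 2 * α * (M * θ)).tendsto _
  exact ge_of_tendsto ht (by filter_upwards [self_mem_nhdsWithin] with M hM using hMbd M hM)

lemma lowerBoundA_lt {α β : ℝ} (hα : 0 < α) (hβ : β = 1 / (2 * α)) (hs : 2 * α ^ 2 ≠ 1) :
    lowerBoundA α β < lowerBoundA (1 / Real.sqrt 2) (1 / Real.sqrt 2) := by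
  have h1 : lowerBoundA α β ≤ _ := sSup_le fun A hA ↦ lowerFrameBound_le hα hβ hA
  have h2 : _ ≤ lowerBoundA (1 / Real.sqrt 2) (1 / Real.sqrt 2) := le_sSup isLowerFrameBound_square
  refine h1.trans_lt (lt_of_lt_of_le ?_ h2)
  have hθ := thetaFour_one_pos
  rw [ENNReal.ofReal_lt_ofReal_iff (by positivity)]
  have := thetaFour_mul_lt (by positivity : 0 < 2 * α ^ 2) hs
  linarith

lemma tolimieriOrrBound_lt {α β t : ℝ} (hα : 0 < α) (hβ : β = 1 / (2 * α)) (ht : 0 < t)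
    (hs : 2 * α ^ 2 ≠ 1) :
    tolimieriOrrBound (t / Real.sqrt 2) (t / Real.sqrt 2) < tolimieriOrrBound (t * α) (t * β) := by
  have hβ0 : 0 < β := by rw [hβ]; positivity
  rw [tolimieriOrrBound_eq (by positivity) (by positivity),
    tolimieriOrrBound_eq (by positivity) (by positivity)]
  have hr : 0 < 1 / t ^ 2 := by positivity
  have hs0 : 0 < 2 * α ^ 2 := by positivity
  have e1 : 1 / (2 * (t / Real.sqrt 2) ^ 2) = 1 / t ^ 2 := by
    rw [div_pow, Real.sq_sqrt (by norm_num)]; field_simp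
  have e2 : 1 / (2 * (t * β) ^ 2) = 1 / t ^ 2 * (2 * α ^ 2) := by rw [hβ]; field_simp
  have e3 : 1 / (2 * (t * α) ^ 2) = 1 / t ^ 2 * (1 / (2 * α ^ 2)) := by field_simp
  rw [e1, e2, e3, ENNReal.ofReal_lt_ofReal_iff
    (mul_pos (thetaThree_pos (by positivity)) (thetaThree_pos (by positivity))), ← sq]
  exact sq_thetaThree_lt hr hs0 hs

end

theorem theorem1p1 (α β : ℝ) (hα : 0 < α) (hβ : 0 < β) (hαβ : (α * β)⁻¹ = 2) :
    ((∀ t : ℝ, 0 < t →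
        tolimieriOrrBound (t / Real.sqrt 2) (t / Real.sqrt 2) ≤ tolimieriOrrBound (t * α) (t * β)) →
      lowerBoundA (1 / Real.sqrt 2) (1 / Real.sqrt 2) ≥ lowerBoundA α β) ∧
    (∀ t : ℝ, 0 < t →
      tolimieriOrrBound (t / Real.sqrt 2) (t / Real.sqrt 2) = tolimieriOrrBound (t * α) (t * β) →
        α = 1 / Real.sqrt 2 ∧ β = 1 / Real.sqrt 2) ∧
    (lowerBoundA (1 / Real.sqrt 2) (1 / Real.sqrt 2) = lowerBoundA α β →
      α = 1 / Real.sqrt 2 ∧ β = 1 / Real.sqrt 2) := by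
  have hβ' : β = 1 / (2 * α) := by
    rw [← hαβ]; field_simp
  have hsq : 2 * α ^ 2 = 1 → α = 1 / Real.sqrt 2 ∧ β = 1 / Real.sqrt 2 := by
    intro h
    have h2 : Real.sqrt 2 ^ 2 = 2 := Real.sq_sqrt (by norm_num)
    have hα' : α = 1 / Real.sqrt 2 := by
      rw [← sq_eq_sq₀ hα.le (by positivity), div_pow, h2]; linarith
    refine ⟨hα', ?_⟩
    rw [hβ', hα']
    field_simp
    linarith
  refine ⟨fun _ ↦ ?_, fun t ht h ↦ ?_, fun h ↦ ?_⟩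
  · by_cases hs : 2 * α ^ 2 = 1
    · obtain ⟨h1, h2⟩ := hsq hs
      rw [h1, h2]
    · exact (lowerBoundA_lt hα hβ' hs).le
  · by_contra hne
    exact (tolimieriOrrBound_lt hα hβ' ht (fun hs ↦ hne (hsq hs))).ne h
  · by_contra hne
    exact (lowerBoundA_lt hα hβ' (fun hs ↦ hne (hsq hs))).ne' h
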